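/- Let $X$ be a compact (Hausdorff) complex manifold of complex dimension $n$ with a smooth Kähler metric $g_{i\bar j}$, Kähler form $\omega=\sqrt{-1}\,g_{i\bar j}\,dz^i\wedge d\bar z^j$ and Ricci curvature $R_{i\bar j}=-\partial_i\partial_{\bar j}\log\det(g_{k\bar l})$. Let $u:X\to\mathbb R$ be a smooth function with $$R_{i\bar j}-g_{i\bar j}=-u_{i\bar j},\qquad u_{i\bar j}=\partial_i\partial_{\bar j}u .$$ Write $\nabla^j u=g^{j\bar k}u_{\bar k}$, $\nabla^{\bar k}u=g^{j\bar k}u_j$, $|\nabla u|^2=g^{j\bar k}u_ju_{\bar k}$, $\Delta u=g^{j\bar k}u_{j\bar k}$, $\|\nabla u\|_{C^0}=\sup_X|\nabla u|$ and $\|\Delta u\|_{C^0}=\sup_X|\Delta u|$. Then both suprema are finite, the two integrands below are integrable, and $$\left|\int_X u_{j\bar k}\,\nabla^j u\,\nabla^{\bar k}u\;\omega^n\right|\le 5\left(\|\nabla u\|_{C^0}^2+\|\Delta u\|_{C^0}\right)\int_X|\nabla u|^2\,\omega^n .$$ -/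

import Mathlib

open scoped Manifold ContDiff Matrix
open MeasureTheory

noncomputable section

namespace Kahler

/-! ### Wirtinger derivatives on `ℂⁿ` -/

/-- `∂_i f = ∂f/∂zⁱ = (∂f/∂xⁱ - √-1 ∂f/∂yⁱ)/2`, for `f` on (an open subset of) `ℂⁿ`, where
`zⁱ = xⁱ + √-1 yⁱ`. -/
def dz {n : ℕ} (i : Fin n) (f : (Fin n → ℂ) → ℂ) (z : Fin n → ℂ) : ℂ :=
  (fderiv ℝ f z (Pi.single i 1) - Complex.I * fderiv ℝ f z (Pi.single i Complex.I)) / 2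

/-- `∂_{\bar i} f = ∂f/∂z̄ⁱ = (∂f/∂xⁱ + √-1 ∂f/∂yⁱ)/2`. -/
def dzbar {n : ℕ} (i : Fin n) (f : (Fin n → ℂ) → ℂ) (z : Fin n → ℂ) : ℂ :=
  (fderiv ℝ f z (Pi.single i 1) + Complex.I * fderiv ℝ f z (Pi.single i Complex.I)) / 2

section Defs

variable {n : ℕ} {X : Type*} [TopologicalSpace X] [ChartedSpace (Fin n → ℂ) X]

/-- The holomorphic coordinate vector `∂/∂zⁱ` of the chart `e` at the point with coordinates `z`.
It is an element of the tangent space of the complex manifold `X`, which as a complex vector space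
is `T^{1,0}X`. -/
def coordVec (e : OpenPartialHomeomorph X (Fin n → ℂ)) (z : Fin n → ℂ) (i : Fin n) :
    TangentSpace 𝓘(ℂ, Fin n → ℂ) (e.symm z) :=
  mfderiv 𝓘(ℂ, Fin n → ℂ) 𝓘(ℂ, Fin n → ℂ) e.symm z (Pi.single i 1 : Fin n → ℂ)

/-- The components `h(∂/∂zⁱ, ∂/∂zʲ)` in the chart `e` of a sesquilinear form `h` on the tangent
spaces of `X`, as a function of the coordinates. -/
def formCoeff
    (h : ∀ x : X, TangentSpace 𝓘(ℂ, Fin n → ℂ) x →ₗ[ℂ] TangentSpace 𝓘(ℂ, Fin n → ℂ) x →ₗ⋆[ℂ] ℂ)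
    (e : OpenPartialHomeomorph X (Fin n → ℂ)) (i j : Fin n) (z : Fin n → ℂ) : ℂ :=
  h (e.symm z) (coordVec e z i) (coordVec e z j)

end Defs

/-- A Kähler metric on a complex manifold `X` of dimension `n`: a smooth positive definite
Hermitian form `g` on the holomorphic tangent spaces, whose associated `(1,1)`-form
`ω = √-1 g_{i\bar j} dzⁱ ∧ dz̄ʲ` is closed. -/
structure KahlerMetric (n : ℕ) (X : Type*) [TopologicalSpace X]
    [ChartedSpace (Fin n → ℂ) X] where
  /-- the Hermitian form, linear in the first and conjugate linear in the second variable -/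
  form : ∀ x : X, TangentSpace 𝓘(ℂ, Fin n → ℂ) x →ₗ[ℂ] TangentSpace 𝓘(ℂ, Fin n → ℂ) x →ₗ⋆[ℂ] ℂ
  hermitian : ∀ (x : X) (v w : TangentSpace 𝓘(ℂ, Fin n → ℂ) x),
    form x w v = (starRingEnd ℂ) (form x v w)
  pos : ∀ (x : X) (v : TangentSpace 𝓘(ℂ, Fin n → ℂ) x), v ≠ 0 → 0 < (form x v v).re
  smooth : ∀ e ∈ atlas (Fin n → ℂ) X, ∀ i j : Fin n,
    ContDiffOn ℝ ∞ (formCoeff form e i j) e.target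
  /-- `dω = 0` in coordinates: `∂_k g_{i\bar j} = ∂_i g_{k\bar j}` -/
  closed : ∀ e ∈ atlas (Fin n → ℂ) X, ∀ z ∈ e.target, ∀ i j k : Fin n,
    dz k (formCoeff form e i j) z = dz i (formCoeff form e k j) z

section Chart

/-! ### Tensor calculus in a holomorphic chart `e`, at the point with coordinates `z` -/

variable {n : ℕ} {X : Type*} [TopologicalSpace X] [ChartedSpace (Fin n → ℂ) X]

/-- The Hermitian matrix `(g_{i\bar j})`. -/
def metric (g : KahlerMetric n X) (e : OpenPartialHomeomorph X (Fin n → ℂ)) (z : Fin n → ℂ) :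
    Matrix (Fin n) (Fin n) ℂ :=
  Matrix.of fun i j => formCoeff g.form e i j z

/-- The inverse metric `g^{i\bar j}`, with `∑_j g^{i\bar j} g_{k\bar j} = δ^i_k`. -/
def metricInv (g : KahlerMetric n X) (e : OpenPartialHomeomorph X (Fin n → ℂ)) (i j : Fin n)
    (z : Fin n → ℂ) : ℂ :=
  (metric g e z)⁻¹ j i

/-- The Christoffel symbols `Γ^p_{ki} = g^{p\bar q} ∂_k g_{i\bar q}` of the Levi-Civita (= Chern)
connection. -/
def christoffel (g : KahlerMetric n X) (e : OpenPartialHomeomorph X (Fin n → ℂ)) (p k i : Fin n)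
    (z : Fin n → ℂ) : ℂ :=
  ∑ q, metricInv g e p q z * dz k (fun w => metric g e w i q) z

/-- The curvature `R_i{}^p{}_{k\bar l} = -∂_{\bar l} Γ^p_{ki}`, that is,
`(∇_k ∇_{\bar l} - ∇_{\bar l} ∇_k) ∂_i = R_i{}^p{}_{k\bar l} ∂_p`. -/
def curvature (g : KahlerMetric n X) (e : OpenPartialHomeomorph X (Fin n → ℂ)) (i p k l : Fin n)
    (z : Fin n → ℂ) : ℂ :=
  -dzbar l (christoffel g e p k i) z

/-- The Ricci curvature `R_{i\bar l} = ∑_k R_i{}^k{}_{k\bar l}` (which is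
`g^{k\bar j} R_{i\bar j k\bar l} = -∂_i ∂_{\bar l} log det g`). -/
def ricci (g : KahlerMetric n X) (e : OpenPartialHomeomorph X (Fin n → ℂ)) (i l : Fin n)
    (z : Fin n → ℂ) : ℂ :=
  ∑ k, curvature g e i k k l z

/-- A real function on `X` written in the chart `e`, with values in `ℂ`. -/
def inChart (u : X → ℝ) (e : OpenPartialHomeomorph X (Fin n → ℂ)) (z : Fin n → ℂ) : ℂ :=
  (u (e.symm z) : ℂ)

/-- `u_{j\bar k} = ∇_j ∇_{\bar k} u = ∂_j ∂_{\bar k} u` (the mixed Christoffel symbols vanish). -/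
def hess (u : X → ℝ) (e : OpenPartialHomeomorph X (Fin n → ℂ)) (j k : Fin n)
    (z : Fin n → ℂ) : ℂ :=
  dz j (dzbar k (inChart u e)) z

/-- `∇^j u = g^{j\bar k} u_{\bar k}`. -/
def gradUp (g : KahlerMetric n X) (u : X → ℝ) (e : OpenPartialHomeomorph X (Fin n → ℂ))
    (j : Fin n) (z : Fin n → ℂ) : ℂ :=
  ∑ k, metricInv g e j k z * dzbar k (inChart u e) z

/-- `∇^{\bar k} u = g^{j\bar k} u_j`. -/
def gradUpBar (g : KahlerMetric n X) (u : X → ℝ) (e : OpenPartialHomeomorph X (Fin n → ℂ))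
    (k : Fin n) (z : Fin n → ℂ) : ℂ :=
  ∑ j, metricInv g e j k z * dz j (inChart u e) z

/-- The volume form `ωⁿ = 2ⁿ n! det(g_{i\bar j}) dx¹ dy¹ ⋯ dxⁿ dyⁿ` in the chart `e`, as a
measure on `X` concentrated on the domain of `e`. -/
def chartVolume [MeasurableSpace X] (g : KahlerMetric n X)
    (e : OpenPartialHomeomorph X (Fin n → ℂ)) : Measure X :=
  Measure.map e.symm <| (volume.restrict e.target).withDensity fun z =>
    ENNReal.ofReal (2 ^ n * (n.factorial : ℝ) * (metric g e z).det.re)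

end Chart

section Global

/-! ### Objects on `X` -/

variable {n : ℕ} {X : Type*} [TopologicalSpace X] [ChartedSpace (Fin n → ℂ) X]

/-- The measure `ωⁿ` on `X`. The measures that `ωⁿ` induces on the chart domains agree on
overlaps (the Jacobian of a holomorphic coordinate change `φ` is `|det ∂φ|²`), so the least
measure that dominates all of them is the one that restricts to each of them. -/
def volumeMeasure [MeasurableSpace X] (g : KahlerMetric n X) : Measure X :=
  ⨆ e ∈ atlas (Fin n → ℂ) X, chartVolume g e

/-- `|∇u|² = g^{j\bar k} u_j u_{\bar k}` at `x`, computed in the preferred chart at `x`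
(the value does not depend on the chart, and is real). -/
def gradSq (g : KahlerMetric n X) (u : X → ℝ) (x : X) : ℝ :=
  let e := chartAt (Fin n → ℂ) x
  (∑ j, ∑ k, metricInv g e j k (e x) * dz j (inChart u e) (e x)
    * dzbar k (inChart u e) (e x)).re

/-- The Laplacian `Δu = g^{j\bar k} u_{j\bar k}` at `x` (independent of the chart, and real). -/
def laplacian (g : KahlerMetric n X) (u : X → ℝ) (x : X) : ℝ :=
  let e := chartAt (Fin n → ℂ) x
  (∑ j, ∑ k, metricInv g e j k (e x) * hess u e j k (e x)).re

/-- `u_{j\bar k} ∇^j u ∇^{\bar k} u` at `x` (independent of the chart). -/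
def hessGradGrad (g : KahlerMetric n X) (u : X → ℝ) (x : X) : ℂ :=
  let e := chartAt (Fin n → ℂ) x
  ∑ j, ∑ k, hess u e j k (e x) * gradUp g u e j (e x) * gradUpBar g u e k (e x)

/-- `R_{i\bar j} - g_{i\bar j} = -u_{i\bar j}` on `X`. -/
def IsRicciPotential (g : KahlerMetric n X) (u : X → ℝ) : Prop :=
  ∀ e ∈ atlas (Fin n → ℂ) X, ∀ z ∈ e.target, ∀ i j : Fin n,
    ricci g e i j z - metric g e z i j = -hess u e i j z

end Global

end Kahler

end

/-!
The estimate is the integrated Bochner formula for `f = |∇u|²`, multiplied by `f` itself.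

With `Ric(∇u, ∇u) = f - B`, where `B = u_{j\bar k} ∇^j u ∇^{\bar k} u`, the Bochner formula
(`Kahler.chart_bochner`) reads
`Δf = |∇∇u|² + |∇∇̄u|² + 2 Re ⟨∂Δu, ∂u⟩ + f - B`.
Drop `|∇∇u|² ≥ 0`, multiply by `f`, and put `q = |∂f|²`. Since
`div (f ∂f) = f Δf + q` and `div (f Δu ∂u) = f (Δu)² + Re ⟨∂(f Δu), ∂u⟩`, completing the square
`|∂f - Δu ∂u|² ≥ 0` gives
`f |∇∇̄u|² - f |B| - 3 f (Δu)² ≤ D` with a divergence `D`. By Cauchy-Schwarz `|B| ≤ |∇∇̄u| f`, and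
with `S = sup f`, `M = sup |Δu|` a quadratic inequality in `|∇∇̄u|` yields the pointwise bound
`(S + M) |B| ≤ 5 (S + M)² f + D` (`Kahler.pointwise_estimate`). Integrating it and dividing by
`S + M` is the claim.

The integral of `D` vanishes by Green's formula (`Kahler.integral_green`). A partition of unity
reduces it to functions supported in a chart, where it is the vanishing of the integral of a
compactly supported divergence: by the Kähler condition, the derivatives of `det g` cancel those of
the inverse metric, so that `det g · Δu = ∂_j (det g · ∇^j u)` (`Kahler.sum_dz_mul_gradUp`). For
this, `ωⁿ` is identified in each chart with the density `2ⁿ n! det g`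
(`Kahler.volumeMeasure_apply_of_subset`), by the change of variables formula and the fact that a
holomorphic coordinate change with complex Jacobian matrix `A` has real Jacobian determinant
`|det A|²`. The functions `f` and `Δu` are smooth, and `B` is continuous, because their coordinate
expressions do not depend on the chart.
-/

namespace Kahler

/-! ### Wirtinger calculus -/

section Wirtinger

variable {n : ℕ} {f g : (Fin n → ℂ) → ℂ} {z : Fin n → ℂ} {i j : Fin n}

open Filter Topology ComplexConjugate

lemma fderiv_apply_eq_sum (f : (Fin n → ℂ) → ℂ) (z w : Fin n → ℂ) :
    fderiv ℝ f z w = ∑ a, (dz a f z * w a + dzbar a f z * conj (w a)) := by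
  have hw : w = ∑ a, ((w a).re • (Pi.single a 1 : Fin n → ℂ)
      + (w a).im • (Pi.single a Complex.I : Fin n → ℂ)) := by
    ext b
    simp [Finset.sum_apply, Pi.single_apply, Finset.sum_add_distrib]
  conv_lhs => rw [hw]
  rw [map_sum]
  refine Finset.sum_congr rfl fun a _ => ?_
  rw [map_add, map_smul, map_smul, dz, dzbar]
  have h1 : w a = (w a).re + (w a).im * Complex.I := (Complex.re_add_im _).symm
  have h2 : conj (w a) = (w a).re - (w a).im * Complex.I := by
    conv_lhs => rw [h1]
    simp only [map_add, map_mul, Complex.conj_ofReal, Complex.conj_I]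
    ring
  rw [h2]
  nth_rw 3 [h1]
  simp only [Complex.real_smul]
  linear_combination ((w a).im * fderiv ℝ f z (Pi.single a Complex.I)) * Complex.I_sq

lemma dz_congr (h : f =ᶠ[𝓝 z] g) : dz i f z = dz i g z := by
  rw [dz, dz, h.fderiv_eq]

lemma dzbar_congr (h : f =ᶠ[𝓝 z] g) : dzbar i f z = dzbar i g z := by
  rw [dzbar, dzbar, h.fderiv_eq]

lemma dzbar_add (hf : DifferentiableAt ℝ f z) (hg : DifferentiableAt ℝ g z) :
    dzbar i (fun w => f w + g w) z = dzbar i f z + dzbar i g z := by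
  simp only [dzbar, fderiv_fun_add hf hg, add_apply]
  ring

lemma dzbar_sub (hf : DifferentiableAt ℝ f z) (hg : DifferentiableAt ℝ g z) :
    dzbar i (fun w => f w - g w) z = dzbar i f z - dzbar i g z := by
  simp only [dzbar, fderiv_fun_sub hf hg, sub_apply]
  ring

lemma dz_mul (hf : DifferentiableAt ℝ f z) (hg : DifferentiableAt ℝ g z) :
    dz i (fun w => f w * g w) z = dz i f z * g z + f z * dz i g z := by
  simp only [dz, fderiv_fun_mul hf hg, add_apply,
    smul_apply, smul_eq_mul]
  ring

lemma dzbar_mul (hf : DifferentiableAt ℝ f z) (hg : DifferentiableAt ℝ g z) :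
    dzbar i (fun w => f w * g w) z = dzbar i f z * g z + f z * dzbar i g z := by
  simp only [dzbar, fderiv_fun_mul hf hg, add_apply,
    smul_apply, smul_eq_mul]
  ring

lemma dz_const (c : ℂ) : dz i (fun _ => c) z = 0 := by
  simp [dz]

lemma dzbar_const (c : ℂ) : dzbar i (fun _ => c) z = 0 := by
  simp [dzbar]

lemma dz_sum {ι : Type*} (s : Finset ι) {F : ι → (Fin n → ℂ) → ℂ}
    (hF : ∀ a ∈ s, DifferentiableAt ℝ (F a) z) :
    dz i (fun w => ∑ a ∈ s, F a w) z = ∑ a ∈ s, dz i (F a) z := by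
  simp only [dz, fderiv_fun_sum hF, sum_apply, Finset.mul_sum,
    ← Finset.sum_sub_distrib, Finset.sum_div]

lemma dzbar_sum {ι : Type*} (s : Finset ι) {F : ι → (Fin n → ℂ) → ℂ}
    (hF : ∀ a ∈ s, DifferentiableAt ℝ (F a) z) :
    dzbar i (fun w => ∑ a ∈ s, F a w) z = ∑ a ∈ s, dzbar i (F a) z := by
  simp only [dzbar, fderiv_fun_sum hF, sum_apply, Finset.mul_sum,
    ← Finset.sum_add_distrib, Finset.sum_div]

lemma fderiv_conj_apply (hf : DifferentiableAt ℝ f z) (v : Fin n → ℂ) :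
    fderiv ℝ (fun w => conj (f w)) z v = conj (fderiv ℝ f z v) := by
  have h := (Complex.conjCLE.toContinuousLinearMap.hasFDerivAt (x := f z)).comp z hf.hasFDerivAt
  have h' : HasFDerivAt (fun w => conj (f w))
    ((Complex.conjCLE : ℂ →L[ℝ] ℂ).comp (fderiv ℝ f z)) z := h
  rw [h'.fderiv]
  simp

lemma dz_conj (hf : DifferentiableAt ℝ f z) :
    dz i (fun w => conj (f w)) z = conj (dzbar i f z) := by
  simp only [dz, dzbar, fderiv_conj_apply hf, map_div₀, map_add, map_mul, Complex.conj_I,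
    map_ofNat]
  ring

lemma dzbar_conj (hf : DifferentiableAt ℝ f z) :
    dzbar i (fun w => conj (f w)) z = conj (dz i f z) := by
  simp only [dz, dzbar, fderiv_conj_apply hf, map_div₀, map_sub, map_mul, Complex.conj_I,
    map_ofNat]
  ring

lemma dzbar_of_holomorphic (hf : DifferentiableAt ℂ f z) : dzbar i f z = 0 := by
  have h : (Pi.single i Complex.I : Fin n → ℂ) = Complex.I • (Pi.single i 1 : Fin n → ℂ) := by
    rw [← Pi.single_smul]; simp
  rw [dzbar, hf.fderiv_restrictScalars ℝ, h]
  simp only [ContinuousLinearMap.coe_restrictScalars', map_smul, smul_eq_mul, ← mul_assoc,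
    Complex.I_mul_I]
  ring

variable {φ : (Fin n → ℂ) → Fin n → ℂ}

lemma fderiv_comp_holomorphic (hφ : DifferentiableAt ℂ φ z) (hf : DifferentiableAt ℝ f (φ z))
    (v : Fin n → ℂ) :
    fderiv ℝ (fun w => f (φ w)) z v = fderiv ℝ f (φ z) (fderiv ℂ φ z v) := by
  have h := (hf.hasFDerivAt.comp z (hφ.restrictScalars ℝ).hasFDerivAt).fderiv
  change fderiv ℝ (f ∘ φ) z v = _
  rw [h, hφ.fderiv_restrictScalars ℝ]
  rfl

lemma dz_comp_holomorphic (hφ : DifferentiableAt ℂ φ z) (hf : DifferentiableAt ℝ f (φ z)) :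
    dz i (fun w => f (φ w)) z = ∑ a, fderiv ℂ φ z (Pi.single i 1) a * dz a f (φ z) := by
  have h : (Pi.single i Complex.I : Fin n → ℂ) = Complex.I • (Pi.single i 1 : Fin n → ℂ) := by
    rw [← Pi.single_smul]; simp
  rw [dz, fderiv_comp_holomorphic hφ hf, fderiv_comp_holomorphic hφ hf, h, map_smul,
    fderiv_apply_eq_sum, fderiv_apply_eq_sum, Finset.mul_sum, ← Finset.sum_sub_distrib,
    Finset.sum_div]
  refine Finset.sum_congr rfl fun a _ => ?_
  simp only [Pi.smul_apply, smul_eq_mul, map_mul, Complex.conj_I]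
  linear_combination (-(dz a f (φ z) * fderiv ℂ φ z (Pi.single i 1) a) / 2 +
    (dzbar a f (φ z) * conj (fderiv ℂ φ z (Pi.single i 1) a)) / 2) * Complex.I_sq

lemma dzbar_comp_holomorphic (hφ : DifferentiableAt ℂ φ z) (hf : DifferentiableAt ℝ f (φ z)) :
    dzbar i (fun w => f (φ w)) z
      = ∑ a, conj (fderiv ℂ φ z (Pi.single i 1) a) * dzbar a f (φ z) := by
  have h : (Pi.single i Complex.I : Fin n → ℂ) = Complex.I • (Pi.single i 1 : Fin n → ℂ) := by
    rw [← Pi.single_smul]; simp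
  rw [dzbar, fderiv_comp_holomorphic hφ hf, fderiv_comp_holomorphic hφ hf, h, map_smul,
    fderiv_apply_eq_sum, fderiv_apply_eq_sum, Finset.mul_sum, ← Finset.sum_add_distrib,
    Finset.sum_div]
  refine Finset.sum_congr rfl fun a _ => ?_
  simp only [Pi.smul_apply, smul_eq_mul, map_mul, Complex.conj_I]
  linear_combination ((dz a f (φ z) * fderiv ℂ φ z (Pi.single i 1) a) / 2 -
    (dzbar a f (φ z) * conj (fderiv ℂ φ z (Pi.single i 1) a)) / 2) * Complex.I_sq

variable {s : Set (Fin n → ℂ)}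

lemma contDiffOn_fderiv_apply (hs : IsOpen s) (hf : ContDiffOn ℝ ∞ f s) (v : Fin n → ℂ) :
    ContDiffOn ℝ ∞ (fun w => fderiv ℝ f w v) s :=
  (hf.fderiv_of_isOpen hs (m := ∞) (by simp)).clm_apply contDiffOn_const

lemma contDiffOn_dz (hs : IsOpen s) (hf : ContDiffOn ℝ ∞ f s) : ContDiffOn ℝ ∞ (dz i f) s :=
  ((contDiffOn_fderiv_apply hs hf _).sub
    (contDiffOn_const.mul (contDiffOn_fderiv_apply hs hf _))).div_const _

lemma contDiffOn_dzbar (hs : IsOpen s) (hf : ContDiffOn ℝ ∞ f s) :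
    ContDiffOn ℝ ∞ (dzbar i f) s :=
  ((contDiffOn_fderiv_apply hs hf _).add
    (contDiffOn_const.mul (contDiffOn_fderiv_apply hs hf _))).div_const _

lemma differentiableAt_of_contDiffOn (hs : IsOpen s) (hf : ContDiffOn ℝ ∞ f s) (hz : z ∈ s) :
    DifferentiableAt ℝ f z :=
  (hf.contDiffAt (hs.mem_nhds hz)).differentiableAt (by simp)

lemma fderiv_fderiv_apply_comm (hs : IsOpen s) (hf : ContDiffOn ℝ ∞ f s) (hz : z ∈ s)
    (v w : Fin n → ℂ) :
    fderiv ℝ (fun x => fderiv ℝ f x v) z w = fderiv ℝ (fun x => fderiv ℝ f x w) z v := by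
  have h1 : DifferentiableAt ℝ (fderiv ℝ f) z :=
    ((hf.fderiv_of_isOpen hs (m := ∞) (by simp)).contDiffAt (hs.mem_nhds hz)).differentiableAt
      (by simp)
  have h2 : IsSymmSndFDerivAt ℝ f z :=
    (hf.contDiffAt (hs.mem_nhds hz)).isSymmSndFDerivAt
      (by simp only [minSmoothness_of_isRCLikeNormedField]; exact WithTop.coe_le_coe.2 le_top)
  rw [fderiv_clm_apply h1 (differentiableAt_const _),
    fderiv_clm_apply h1 (differentiableAt_const _)]
  simpa using h2.eq w v

lemma fderiv_dz_apply (hs : IsOpen s) (hf : ContDiffOn ℝ ∞ f s) (hz : z ∈ s) (v : Fin n → ℂ) :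
    fderiv ℝ (dz i f) z v = dz i (fun x => fderiv ℝ f x v) z := by
  have h1 := fun v => differentiableAt_of_contDiffOn hs (contDiffOn_fderiv_apply hs hf v) hz
  have : HasFDerivAt (dz i f) (((2 : ℂ)⁻¹) • (fderiv ℝ (fun w => fderiv ℝ f w (Pi.single i 1)) z
      - Complex.I • fderiv ℝ (fun w => fderiv ℝ f w (Pi.single i Complex.I)) z)) z := by
    have := ((h1 (Pi.single i 1)).hasFDerivAt.sub
      ((h1 (Pi.single i Complex.I)).hasFDerivAt.const_mul Complex.I)).const_mul ((2 : ℂ)⁻¹)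
    refine this.congr_of_eventuallyEq (Eventually.of_forall fun w => ?_)
    simp [dz]; ring
  rw [this.fderiv, dz, fderiv_fderiv_apply_comm hs hf hz v, fderiv_fderiv_apply_comm hs hf hz v]
  simp; ring

lemma fderiv_dzbar_apply (hs : IsOpen s) (hf : ContDiffOn ℝ ∞ f s) (hz : z ∈ s)
    (v : Fin n → ℂ) :
    fderiv ℝ (dzbar i f) z v = dzbar i (fun x => fderiv ℝ f x v) z := by
  have h1 := fun v => differentiableAt_of_contDiffOn hs (contDiffOn_fderiv_apply hs hf v) hz
  have : HasFDerivAt (dzbar i f) (((2 : ℂ)⁻¹) • (fderiv ℝ (fun w => fderiv ℝ f w (Pi.single i 1)) z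
      + Complex.I • fderiv ℝ (fun w => fderiv ℝ f w (Pi.single i Complex.I)) z)) z := by
    have := ((h1 (Pi.single i 1)).hasFDerivAt.add
      ((h1 (Pi.single i Complex.I)).hasFDerivAt.const_mul Complex.I)).const_mul ((2 : ℂ)⁻¹)
    refine this.congr_of_eventuallyEq (Eventually.of_forall fun w => ?_)
    simp [dzbar]; ring
  rw [this.fderiv, dzbar, fderiv_fderiv_apply_comm hs hf hz v, fderiv_fderiv_apply_comm hs hf hz v]
  simp; ring

lemma dz_def (f : (Fin n → ℂ) → ℂ) :
    dz i f z = (fderiv ℝ f z (Pi.single i 1)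
      - Complex.I * fderiv ℝ f z (Pi.single i Complex.I)) / 2 := rfl

lemma dzbar_def (f : (Fin n → ℂ) → ℂ) :
    dzbar i f z = (fderiv ℝ f z (Pi.single i 1)
      + Complex.I * fderiv ℝ f z (Pi.single i Complex.I)) / 2 := rfl

lemma dz_dz_comm (hs : IsOpen s) (hf : ContDiffOn ℝ ∞ f s) (hz : z ∈ s) :
    dz i (dz j f) z = dz j (dz i f) z := by
  have c := fderiv_fderiv_apply_comm hs hf hz
  rw [dz_def (dz j f), fderiv_dz_apply hs hf hz, fderiv_dz_apply hs hf hz, dz_def (dz i f),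
    fderiv_dz_apply hs hf hz, fderiv_dz_apply hs hf hz]
  simp only [dz]
  rw [c (Pi.single j 1) (Pi.single i 1), c (Pi.single j Complex.I) (Pi.single i 1),
    c (Pi.single j 1) (Pi.single i Complex.I), c (Pi.single j Complex.I) (Pi.single i Complex.I)]
  ring

lemma dzbar_dzbar_comm (hs : IsOpen s) (hf : ContDiffOn ℝ ∞ f s) (hz : z ∈ s) :
    dzbar i (dzbar j f) z = dzbar j (dzbar i f) z := by
  have c := fderiv_fderiv_apply_comm hs hf hz
  rw [dzbar_def (dzbar j f), fderiv_dzbar_apply hs hf hz, fderiv_dzbar_apply hs hf hz,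
    dzbar_def (dzbar i f), fderiv_dzbar_apply hs hf hz, fderiv_dzbar_apply hs hf hz]
  simp only [dzbar]
  rw [c (Pi.single j 1) (Pi.single i 1), c (Pi.single j Complex.I) (Pi.single i 1),
    c (Pi.single j 1) (Pi.single i Complex.I), c (Pi.single j Complex.I) (Pi.single i Complex.I)]
  ring

lemma dz_dzbar_comm (hs : IsOpen s) (hf : ContDiffOn ℝ ∞ f s) (hz : z ∈ s) :
    dz i (dzbar j f) z = dzbar j (dz i f) z := by
  have c := fderiv_fderiv_apply_comm hs hf hz
  rw [dz_def (dzbar j f), fderiv_dzbar_apply hs hf hz, fderiv_dzbar_apply hs hf hz,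
    dzbar_def (dz i f), fderiv_dz_apply hs hf hz, fderiv_dz_apply hs hf hz]
  simp only [dz, dzbar]
  rw [c (Pi.single j 1) (Pi.single i 1), c (Pi.single j Complex.I) (Pi.single i 1),
    c (Pi.single j 1) (Pi.single i Complex.I), c (Pi.single j Complex.I) (Pi.single i Complex.I)]
  ring

end Wirtinger

/-! ### Pointwise inequalities for Hermitian matrices -/

section LinearAlgebra

open scoped ComplexOrder

variable {n : ℕ}

lemma norm_dotProduct_sq_le (p q : Fin n → ℂ) :
    ‖p ⬝ᵥ q‖ ^ 2 ≤ (∑ i, ‖p i‖ ^ 2) * ∑ i, ‖q i‖ ^ 2 := by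
  have h : ‖p ⬝ᵥ q‖ ≤ ∑ i, ‖p i‖ * ‖q i‖ := by
    simpa only [dotProduct, norm_mul] using norm_sum_le Finset.univ fun i => p i * q i
  exact (pow_le_pow_left₀ (norm_nonneg _) h 2).trans (Finset.sum_mul_sq_le_sq_mul_sq _ _ _)

lemma re_star_dotProduct_self (p : Fin n → ℂ) : (star p ⬝ᵥ p).re = ∑ i, ‖p i‖ ^ 2 := by
  simp [dotProduct, Complex.re_sum, ← Complex.normSq_eq_norm_sq, Complex.normSq_apply]

lemma re_trace_mul_conjTranspose (K : Matrix (Fin n) (Fin n) ℂ) :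
    (K * Kᴴ).trace.re = ∑ i, ∑ j, ‖K i j‖ ^ 2 := by
  simp [Matrix.trace, Matrix.mul_apply, Complex.re_sum, ← Complex.normSq_eq_norm_sq,
    Complex.normSq_apply]

lemma sum_norm_sq_mulVec_le (K : Matrix (Fin n) (Fin n) ℂ) (p : Fin n → ℂ) :
    ∑ i, ‖(K *ᵥ p) i‖ ^ 2 ≤ (∑ i, ∑ j, ‖K i j‖ ^ 2) * ∑ i, ‖p i‖ ^ 2 := by
  rw [Finset.sum_mul]
  exact Finset.sum_le_sum fun i _ => norm_dotProduct_sq_le _ _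

variable {P : Matrix (Fin n) (Fin n) ℂ}

lemma exists_eq_conjTranspose_mul_self (hP : P.PosDef) :
    ∃ C : Matrix (Fin n) (Fin n) ℂ, P = Cᴴ * C := by
  open scoped MatrixOrder in
  exact CStarAlgebra.nonneg_iff_eq_star_mul_self.mp hP.posSemidef.nonneg

lemma star_dotProduct_conjTranspose_mul_mulVec (C : Matrix (Fin n) (Fin n) ℂ) (v w : Fin n → ℂ) :
    star w ⬝ᵥ (Cᴴ * C) *ᵥ v = star (C *ᵥ w) ⬝ᵥ C *ᵥ v := by
  rw [← Matrix.mulVec_mulVec, Matrix.dotProduct_mulVec, Matrix.star_mulVec]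

lemma re_star_dotProduct_mulVec_nonneg (hP : P.PosDef) (v : Fin n → ℂ) :
    0 ≤ (star v ⬝ᵥ P *ᵥ v).re := by
  obtain ⟨C, rfl⟩ := exists_eq_conjTranspose_mul_self hP
  rw [star_dotProduct_conjTranspose_mul_mulVec, re_star_dotProduct_self]
  positivity

/-- The Cauchy–Schwarz inequality for a positive definite Hermitian form. -/
lemma norm_star_dotProduct_mulVec_sq_le (hP : P.PosDef) (v w : Fin n → ℂ) :
    ‖star w ⬝ᵥ P *ᵥ v‖ ^ 2 ≤ (star v ⬝ᵥ P *ᵥ v).re * (star w ⬝ᵥ P *ᵥ w).re := by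
  obtain ⟨C, rfl⟩ := exists_eq_conjTranspose_mul_self hP
  simp only [star_dotProduct_conjTranspose_mul_mulVec, re_star_dotProduct_self]
  refine (norm_dotProduct_sq_le _ _).trans_eq ?_
  simp [mul_comm]

lemma trace_mul_mul_mul_self_eq (C : Matrix (Fin n) (Fin n) ℂ) {H : Matrix (Fin n) (Fin n) ℂ}
    (hH : H.IsHermitian) :
    (Cᴴ * C * H * (Cᴴ * C) * H).trace = ((C * H * Cᴴ) * (C * H * Cᴴ)ᴴ).trace := by
  have h := Matrix.trace_mul_comm Cᴴ (C * H * Cᴴ * C * H)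
  simp only [Matrix.conjTranspose_mul, Matrix.conjTranspose_conjTranspose, hH.eq,
    Matrix.mul_assoc] at h ⊢
  exact h

/-- `|H|² = tr (P H P H)` for the inverse metric `P` and a Hermitian form `H`. -/
lemma re_trace_mul_mul_mul_self_nonneg (hP : P.PosDef) {H : Matrix (Fin n) (Fin n) ℂ}
    (hH : H.IsHermitian) : 0 ≤ (P * H * P * H).trace.re := by
  obtain ⟨C, rfl⟩ := exists_eq_conjTranspose_mul_self hP
  rw [trace_mul_mul_mul_self_eq C hH, re_trace_mul_conjTranspose]
  positivity

/-- `|T|² = tr (P T Pᵀ Tᴴ)` for the inverse metric `P` and a tensor `T` of type `(2, 0)`. -/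
lemma re_trace_mul_mul_transpose_mul_conjTranspose_nonneg (hP : P.PosDef)
    (T : Matrix (Fin n) (Fin n) ℂ) : 0 ≤ (P * T * Pᵀ * Tᴴ).trace.re := by
  obtain ⟨C, rfl⟩ := exists_eq_conjTranspose_mul_self hP
  have h : (Cᴴ * C * T * (Cᴴ * C)ᵀ * Tᴴ).trace = ((C * T * Cᵀ) * (C * T * Cᵀ)ᴴ).trace := by
    rw [Matrix.conjTranspose_mul, Matrix.conjTranspose_mul, Matrix.transpose_mul,
      Matrix.mul_assoc, Matrix.mul_assoc, Matrix.mul_assoc, Matrix.trace_mul_comm]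
    simp only [Matrix.mul_assoc]
    rfl
  rw [h, re_trace_mul_conjTranspose]
  positivity

/-- `|H(∇u, ∇u)|² ≤ |H|² |∇u|⁴`. -/
lemma norm_hermitian_form_sq_le (hP : P.PosDef) {H : Matrix (Fin n) (Fin n) ℂ}
    (hH : H.IsHermitian) (v : Fin n → ℂ) :
    ‖(star v ᵥ* P) ⬝ᵥ H *ᵥ (P *ᵥ v)‖ ^ 2
      ≤ (P * H * P * H).trace.re * (star v ⬝ᵥ P *ᵥ v).re ^ 2 := by
  obtain ⟨C, rfl⟩ := exists_eq_conjTranspose_mul_self hP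
  have h2 : (star v ᵥ* (Cᴴ * C)) ⬝ᵥ H *ᵥ ((Cᴴ * C) *ᵥ v)
      = star (C *ᵥ v) ⬝ᵥ (C * H * Cᴴ) *ᵥ (C *ᵥ v) := by
    simp only [← Matrix.mulVec_mulVec, Matrix.dotProduct_mulVec, Matrix.star_mulVec,
      ← Matrix.vecMul_vecMul]
  rw [trace_mul_mul_mul_self_eq C hH, h2, re_trace_mul_conjTranspose,
    star_dotProduct_conjTranspose_mul_mulVec,
    re_star_dotProduct_self]
  refine (norm_dotProduct_sq_le _ _).trans ?_
  have := sum_norm_sq_mulVec_le (C * H * Cᴴ) (C *ᵥ v)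
  simp only [Pi.star_apply, norm_star]
  nlinarith [Finset.sum_nonneg fun i (_ : i ∈ Finset.univ) => sq_nonneg ‖(C *ᵥ v) i‖]

end LinearAlgebra

/-! ### The metric and its inverse in a chart -/

section LocalMetric

open Filter Topology ComplexConjugate
open scoped ComplexOrder

variable {n : ℕ} {X : Type*} [TopologicalSpace X] [ChartedSpace (Fin n → ℂ) X]
  {g : KahlerMetric n X} {e : OpenPartialHomeomorph X (Fin n → ℂ)} {z : Fin n → ℂ}

lemma contDiffOn_metric (he : e ∈ atlas (Fin n → ℂ) X) (i j : Fin n) :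
    ContDiffOn ℝ ∞ (fun w => metric g e w i j) e.target :=
  g.smooth e he i j

lemma metric_isHermitian (g : KahlerMetric n X) (e : OpenPartialHomeomorph X (Fin n → ℂ))
    (z : Fin n → ℂ) : (metric g e z).IsHermitian := by
  ext i j
  rw [Matrix.conjTranspose_apply, metric, Matrix.of_apply, Matrix.of_apply, formCoeff, formCoeff,
    g.hermitian _ (coordVec e z i), ]
  simp

lemma conj_metric (i j : Fin n) : conj (metric g e z i j) = metric g e z j i :=
  (metric_isHermitian g e z).apply j i

lemma dz_metric_comm (he : e ∈ atlas (Fin n → ℂ) X) (hz : z ∈ e.target) (k i j : Fin n) :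
    dz k (fun w => metric g e w i j) z = dz i (fun w => metric g e w k j) z :=
  g.closed e he z hz i j k

lemma dzbar_metric_eq (he : e ∈ atlas (Fin n → ℂ) X) (hz : z ∈ e.target) (k i j : Fin n) :
    dzbar k (fun w => metric g e w i j) z = conj (dz k (fun w => metric g e w j i) z) := by
  rw [← dzbar_conj (differentiableAt_of_contDiffOn e.open_target (contDiffOn_metric he _ _) hz)]
  simp only [conj_metric]

lemma dzbar_metric_comm (he : e ∈ atlas (Fin n → ℂ) X) (hz : z ∈ e.target) (k i j : Fin n) :
    dzbar k (fun w => metric g e w i j) z = dzbar j (fun w => metric g e w i k) z := by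
  rw [dzbar_metric_eq he hz, dzbar_metric_eq he hz, dz_metric_comm he hz]

/-- `∂_l` applied to the entries of a matrix-valued function. -/
noncomputable def dzMat (l : Fin n) (A : (Fin n → ℂ) → Matrix (Fin n) (Fin n) ℂ)
    (z : Fin n → ℂ) :
    Matrix (Fin n) (Fin n) ℂ :=
  Matrix.of fun i j => dz l (fun w => A w i j) z

/-- `∂_{\bar l}` applied to the entries of a matrix-valued function. -/
noncomputable def dzbarMat (l : Fin n) (A : (Fin n → ℂ) → Matrix (Fin n) (Fin n) ℂ)
    (z : Fin n → ℂ) :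
    Matrix (Fin n) (Fin n) ℂ :=
  Matrix.of fun i j => dzbar l (fun w => A w i j) z

lemma dzMat_mul {l : Fin n} {A B : (Fin n → ℂ) → Matrix (Fin n) (Fin n) ℂ}
    (hA : ∀ i j, DifferentiableAt ℝ (fun w => A w i j) z)
    (hB : ∀ i j, DifferentiableAt ℝ (fun w => B w i j) z) :
    dzMat l (fun w => A w * B w) z = dzMat l A z * B z + A z * dzMat l B z := by
  ext i j
  simp only [dzMat, Matrix.mul_apply, Matrix.of_apply, Matrix.add_apply]
  rw [dz_sum _ fun k _ => (hA i k).fun_mul (hB k j), ← Finset.sum_add_distrib]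
  exact Finset.sum_congr rfl fun k _ => dz_mul (hA i k) (hB k j)

lemma dzbarMat_mul {l : Fin n} {A B : (Fin n → ℂ) → Matrix (Fin n) (Fin n) ℂ}
    (hA : ∀ i j, DifferentiableAt ℝ (fun w => A w i j) z)
    (hB : ∀ i j, DifferentiableAt ℝ (fun w => B w i j) z) :
    dzbarMat l (fun w => A w * B w) z = dzbarMat l A z * B z + A z * dzbarMat l B z := by
  ext i j
  simp only [dzbarMat, Matrix.mul_apply, Matrix.of_apply, Matrix.add_apply]
  rw [dzbar_sum _ fun k _ => (hA i k).fun_mul (hB k j), ← Finset.sum_add_distrib]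
  exact Finset.sum_congr rfl fun k _ => dzbar_mul (hA i k) (hB k j)

lemma contDiffOn_det {s : Set (Fin n → ℂ)} {A : (Fin n → ℂ) → Matrix (Fin n) (Fin n) ℂ}
    (hA : ∀ i j, ContDiffOn ℝ ∞ (fun w => A w i j) s) :
    ContDiffOn ℝ ∞ (fun w => (A w).det) s := by
  simp only [Matrix.det_apply']
  exact ContDiffOn.sum fun σ _ => contDiffOn_const.mul (contDiffOn_prod fun i _ => hA _ _)

lemma contDiffOn_metric_det (he : e ∈ atlas (Fin n → ℂ) X) :
    ContDiffOn ℝ ∞ (fun w => (metric g e w).det) e.target :=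
  contDiffOn_det fun i j => contDiffOn_metric he i j

lemma differentiableAt_metric (he : e ∈ atlas (Fin n → ℂ) X) (hz : z ∈ e.target) (i j : Fin n) :
    DifferentiableAt ℝ (fun w => metric g e w i j) z :=
  differentiableAt_of_contDiffOn e.open_target (contDiffOn_metric he i j) hz

lemma christoffel_comm (he : e ∈ atlas (Fin n → ℂ) X) (hz : z ∈ e.target) (p k i : Fin n) :
    christoffel g e p k i z = christoffel g e p i k z :=
  Finset.sum_congr rfl fun q _ => by rw [dz_metric_comm he hz]

lemma christoffel_eq_mul (p k i : Fin n) :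
    christoffel g e p k i z = (dzMat k (metric g e) z * (metric g e z)⁻¹) i p := by
  simp only [christoffel, Matrix.mul_apply, dzMat, Matrix.of_apply, metricInv]
  exact Finset.sum_congr rfl fun q _ => mul_comm _ _

lemma coordVec_eq (e : OpenPartialHomeomorph X (Fin n → ℂ)) (z c : Fin n → ℂ) :
    mfderiv 𝓘(ℂ, Fin n → ℂ) 𝓘(ℂ, Fin n → ℂ) e.symm z c = ∑ i, c i • coordVec e z i := by
  have hc : c = ∑ i, c i • (Pi.single i 1 : Fin n → ℂ) := by
    ext b
    simp [Finset.sum_apply, Pi.single_apply]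
  have h := congrArg (mfderiv 𝓘(ℂ, Fin n → ℂ) 𝓘(ℂ, Fin n → ℂ) e.symm z) hc
  refine h.trans ?_
  erw [map_sum]
  refine Finset.sum_congr rfl fun i _ => ?_
  erw [map_smul]
  rfl

lemma form_sum_smul (x : X) (v : Fin n → TangentSpace 𝓘(ℂ, Fin n → ℂ) x) (c d : Fin n → ℂ) :
    g.form x (∑ i, c i • v i) (∑ j, d j • v j)
      = ∑ i, ∑ j, c i * conj (d j) * g.form x (v i) (v j) := by
  simp only [map_sum, LinearMap.sum_apply, map_smul, LinearMap.smul_apply, smul_eq_mul,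
    LinearMap.map_smulₛₗ]
  simp only [Finset.mul_sum]
  rw [Finset.sum_comm]
  exact Finset.sum_congr rfl fun i _ => Finset.sum_congr rfl fun j _ => by ring

lemma metric_posDef [IsManifold 𝓘(ℂ, Fin n → ℂ) ω X] (he : e ∈ atlas (Fin n → ℂ) X)
    (hz : z ∈ e.target) : (metric g e z).PosDef := by
  refine Matrix.PosDef.of_dotProduct_mulVec_pos (metric_isHermitian g e z) fun c hc => ?_
  have : IsManifold 𝓘(ℂ, Fin n → ℂ) 1 X := .of_le (n := ω) (by simp)
  have hinj := ((mdifferentiable_of_mem_atlas (I := 𝓘(ℂ, Fin n → ℂ)) he).symm).mfderiv_injective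
    (x := z) hz
  set v := mfderiv 𝓘(ℂ, Fin n → ℂ) 𝓘(ℂ, Fin n → ℂ) e.symm z (star c : Fin n → ℂ) with hv
  have hv0 : v ≠ 0 := fun h0 => hc <| by
    have : star c = 0 := hinj
      (h0.trans (map_zero (mfderiv 𝓘(ℂ, Fin n → ℂ) 𝓘(ℂ, Fin n → ℂ) e.symm z)).symm)
    simpa using this
  have hs : star c ⬝ᵥ metric g e z *ᵥ c = g.form _ v v := by
    rw [hv, coordVec_eq, form_sum_smul]
    simp only [dotProduct, Matrix.mulVec, Finset.mul_sum]
    refine Finset.sum_congr rfl fun i _ => Finset.sum_congr rfl fun j _ => ?_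
    simp [metric, formCoeff]
    ring
  have him : (g.form _ v v).im = 0 := Complex.conj_eq_iff_im.1 (g.hermitian _ v v).symm
  rw [hs, Complex.pos_iff]
  exact ⟨g.pos _ v hv0, him.symm⟩

variable [IsManifold 𝓘(ℂ, Fin n → ℂ) ω X]

lemma metric_det_ne_zero (he : e ∈ atlas (Fin n → ℂ) X) (hz : z ∈ e.target) :
    (metric g e z).det ≠ 0 :=
  (metric_posDef he hz).det_pos.ne'

lemma metric_isUnit_det (he : e ∈ atlas (Fin n → ℂ) X) (hz : z ∈ e.target) :
    IsUnit (metric g e z).det :=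
  (metric_det_ne_zero he hz).isUnit

lemma contDiffOn_metricInv (he : e ∈ atlas (Fin n → ℂ) X) (i j : Fin n) :
    ContDiffOn ℝ ∞ (metricInv g e i j) e.target := by
  have h : ∀ w ∈ e.target, metricInv g e i j w
      = ((metric g e w).det)⁻¹ * ((metric g e w).updateRow i (Pi.single j 1)).det := by
    intro w _
    rw [metricInv, Matrix.inv_def, Matrix.smul_apply, Matrix.adjugate_apply, Ring.inverse_eq_inv',
      smul_eq_mul]
  refine ContDiffOn.congr (ContDiffOn.mul ?_ (contDiffOn_det fun k l => ?_)) h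
  · exact (contDiffOn_metric_det he).inv fun w hw => metric_det_ne_zero he hw
  · by_cases hk : k = i
    · subst hk
      simpa using contDiffOn_const
    · simpa [Matrix.updateRow_ne hk] using contDiffOn_metric he k l

lemma inv_mul_metric (he : e ∈ atlas (Fin n → ℂ) X) (hz : z ∈ e.target) :
    (metric g e z)⁻¹ * metric g e z = 1 :=
  Matrix.nonsing_inv_mul _ (metric_isUnit_det he hz)

lemma metric_mul_inv (he : e ∈ atlas (Fin n → ℂ) X) (hz : z ∈ e.target) :
    metric g e z * (metric g e z)⁻¹ = 1 :=
  Matrix.mul_nonsing_inv _ (metric_isUnit_det he hz)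

lemma differentiableAt_metric_inv (he : e ∈ atlas (Fin n → ℂ) X) (hz : z ∈ e.target)
    (i j : Fin n) : DifferentiableAt ℝ (fun w => (metric g e w)⁻¹ i j) z :=
  differentiableAt_of_contDiffOn e.open_target (contDiffOn_metricInv he j i) hz

lemma dzMat_metric_inv (he : e ∈ atlas (Fin n → ℂ) X) (hz : z ∈ e.target) (l : Fin n) :
    dzMat l (fun w => (metric g e w)⁻¹) z
      = -((metric g e z)⁻¹ * dzMat l (metric g e) z * (metric g e z)⁻¹) := by
  have h0 : dzMat l (fun w => (metric g e w)⁻¹ * metric g e w) z = 0 := by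
    ext i j
    rw [dzMat, Matrix.of_apply, dz_congr (g := fun _ => (1 : Matrix (Fin n) (Fin n) ℂ) i j)]
    · exact dz_const _
    · filter_upwards [e.open_target.mem_nhds hz] with w hw
      rw [inv_mul_metric he hw]
  rw [dzMat_mul (differentiableAt_metric_inv he hz) (differentiableAt_metric he hz)] at h0
  have h1 := congrArg (· * (metric g e z)⁻¹) (eq_neg_of_add_eq_zero_left h0)
  simpa only [Matrix.mul_assoc, metric_mul_inv he hz, Matrix.mul_one, Matrix.neg_mul] using h1

lemma dzbarMat_metric_inv (he : e ∈ atlas (Fin n → ℂ) X) (hz : z ∈ e.target) (l : Fin n) :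
    dzbarMat l (fun w => (metric g e w)⁻¹) z
      = -((metric g e z)⁻¹ * dzbarMat l (metric g e) z * (metric g e z)⁻¹) := by
  have h0 : dzbarMat l (fun w => (metric g e w)⁻¹ * metric g e w) z = 0 := by
    ext i j
    rw [dzbarMat, Matrix.of_apply, dzbar_congr (g := fun _ => (1 : Matrix (Fin n) (Fin n) ℂ) i j)]
    · exact dzbar_const _
    · filter_upwards [e.open_target.mem_nhds hz] with w hw
      rw [inv_mul_metric he hw]
  rw [dzbarMat_mul (differentiableAt_metric_inv he hz) (differentiableAt_metric he hz)] at h0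
  have h1 := congrArg (· * (metric g e z)⁻¹) (eq_neg_of_add_eq_zero_left h0)
  simpa only [Matrix.mul_assoc, metric_mul_inv he hz, Matrix.mul_one, Matrix.neg_mul] using h1

lemma contDiffOn_christoffel (he : e ∈ atlas (Fin n → ℂ) X) (p k i : Fin n) :
    ContDiffOn ℝ ∞ (christoffel g e p k i) e.target :=
  ContDiffOn.sum fun q _ => (contDiffOn_metricInv he p q).mul
    (contDiffOn_dz e.open_target (contDiffOn_metric he i q))

lemma sum_christoffel_mul_metric (he : e ∈ atlas (Fin n → ℂ) X) (hz : z ∈ e.target)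
    (k i q : Fin n) :
    ∑ p, christoffel g e p k i z * metric g e z p q = dz k (fun w => metric g e w i q) z := by
  have h : (dzMat k (metric g e) z * (metric g e z)⁻¹ * metric g e z) i q
      = dzMat k (metric g e) z i q := by
    rw [Matrix.mul_assoc, inv_mul_metric he hz, Matrix.mul_one]
  rw [Matrix.mul_apply] at h
  simp only [← christoffel_eq_mul] at h
  exact h

/-- The curvature tensor with all indices lowered is
`R_{j\bar q i\bar l} =
-∂_i ∂_{\bar l} g_{j\bar q} + g^{r\bar s} ∂_i g_{j\bar s} ∂_{\bar l} g_{r\bar q}`. -/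
lemma sum_curvature_mul_metric (he : e ∈ atlas (Fin n → ℂ) X) (hz : z ∈ e.target)
    (j q i l : Fin n) :
    ∑ p, curvature g e j p i l z * metric g e z p q
      = ∑ p, christoffel g e p i j z * dzbar l (fun w => metric g e w p q) z
        - dz i (dzbar l (fun w => metric g e w j q)) z := by
  have hd := fun p => differentiableAt_of_contDiffOn e.open_target
    (contDiffOn_christoffel (g := g) he p i j) hz
  have h1 : dzbar l (fun w => ∑ p, christoffel g e p i j w * metric g e w p q) z
      = dzbar l (dz i (fun w => metric g e w j q)) z := by
    refine dzbar_congr ?_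
    filter_upwards [e.open_target.mem_nhds hz] with w hw
    exact sum_christoffel_mul_metric he hw _ _ _
  rw [dzbar_sum _ fun p _ => (hd p).fun_mul (differentiableAt_metric he hz p q)] at h1
  simp only [dzbar_mul (hd _) (differentiableAt_metric he hz _ q), Finset.sum_add_distrib] at h1
  rw [dz_dzbar_comm e.open_target (contDiffOn_metric he j q) hz, ← h1]
  simp [curvature]

/-- The symmetry `R_{j\bar q i\bar l} = R_{j\bar l i\bar q}`, by the Kähler condition. -/
lemma sum_curvature_mul_metric_comm (he : e ∈ atlas (Fin n → ℂ) X) (hz : z ∈ e.target)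
    (j q i l : Fin n) :
    ∑ p, curvature g e j p i l z * metric g e z p q
      = ∑ p, curvature g e j p i q z * metric g e z p l := by
  rw [sum_curvature_mul_metric he hz, sum_curvature_mul_metric he hz]
  congr 1
  · exact Finset.sum_congr rfl fun p _ => by rw [dzbar_metric_comm he hz]
  · refine dz_congr ?_
    filter_upwards [e.open_target.mem_nhds hz] with w hw
    exact dzbar_metric_comm he hw _ _ _

/-- The two contractions of the Kähler curvature tensor that define the Ricci curvature agree. -/
lemma sum_inv_mul_curvature (he : e ∈ atlas (Fin n → ℂ) X) (hz : z ∈ e.target) (j p : Fin n) :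
    ∑ i, ∑ l, (metric g e z)⁻¹ l i * curvature g e j p i l z
      = ∑ q, ricci g e j q z * (metric g e z)⁻¹ q p := by
  set P := (metric g e z)⁻¹ with hP
  set R : Fin n → Fin n → Fin n → ℂ :=
    fun q i l => ∑ p, curvature g e j p i l z * metric g e z p q with hR
  have hsymm : ∀ q i l, R q i l = R l i q := fun q i l =>
    sum_curvature_mul_metric_comm he hz j q i l
  have hc : ∀ p i l, curvature g e j p i l z = ∑ q, R q i l * P q p := by
    intro p i l
    have h : ((Matrix.of fun (_ : Fin n) p => curvature g e j p i l z) * metric g e z * P) i p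
        = (Matrix.of fun (_ : Fin n) p => curvature g e j p i l z) i p := by
      rw [Matrix.mul_assoc, hP, metric_mul_inv he hz, Matrix.mul_one]
    rw [Matrix.mul_apply] at h
    simpa only [Matrix.mul_apply, Matrix.of_apply] using h.symm
  have hric : ∀ q, ricci g e j q z = ∑ i, ∑ l, P l i * R q i l := by
    intro q
    refine Finset.sum_congr rfl fun k _ => ?_
    rw [hc]
    exact Finset.sum_congr rfl fun s _ => by rw [hsymm, mul_comm]
  simp only [hric, hc p, Finset.mul_sum, Finset.sum_mul]
  calc _ = ∑ i, ∑ q, ∑ l, P l i * (R q i l * P q p) :=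
        Finset.sum_congr rfl fun i _ => Finset.sum_comm
    _ = ∑ q, ∑ i, ∑ l, P l i * (R q i l * P q p) := Finset.sum_comm
    _ = _ := by simp only [mul_assoc]

end LocalMetric

/-! ### The Bochner formula in a chart -/

section Bochner

open Filter Topology ComplexConjugate
open scoped ComplexOrder

section RealFunctions

variable {n : ℕ} {X : Type*} [TopologicalSpace X] {e : OpenPartialHomeomorph X (Fin n → ℂ)}
  {z : Fin n → ℂ} {u : X → ℝ} (hu : ContDiffOn ℝ ∞ (inChart u e) e.target)

/-- The complex Hessian `(u_{j\bar k})` as a matrix. -/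
noncomputable def hessMat (u : X → ℝ) (e : OpenPartialHomeomorph X (Fin n → ℂ))
    (z : Fin n → ℂ) : Matrix (Fin n) (Fin n) ℂ :=
  Matrix.of fun j k => hess u e j k z

include hu

lemma differentiableAt_dz (hz : z ∈ e.target) (j : Fin n) :
    DifferentiableAt ℝ (dz j (inChart u e)) z :=
  differentiableAt_of_contDiffOn e.open_target (contDiffOn_dz e.open_target hu) hz

lemma differentiableAt_dzbar (hz : z ∈ e.target) (j : Fin n) :
    DifferentiableAt ℝ (dzbar j (inChart u e)) z :=
  differentiableAt_of_contDiffOn e.open_target (contDiffOn_dzbar e.open_target hu) hz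

lemma conj_dz (hz : z ∈ e.target) (j : Fin n) :
    conj (dz j (inChart u e) z) = dzbar j (inChart u e) z := by
  rw [← dzbar_conj (differentiableAt_of_contDiffOn e.open_target hu hz)]
  simp only [inChart, Complex.conj_ofReal]
  rfl

lemma conj_dzbar (hz : z ∈ e.target) (j : Fin n) :
    conj (dzbar j (inChart u e) z) = dz j (inChart u e) z := by
  rw [← conj_dz hu hz, Complex.conj_conj]

lemma contDiffOn_hess (j k : Fin n) : ContDiffOn ℝ ∞ (hess u e j k) e.target :=
  contDiffOn_dz e.open_target (contDiffOn_dzbar e.open_target hu)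

lemma hess_eq (hz : z ∈ e.target) (j k : Fin n) :
    hess u e j k z = dzbar k (dz j (inChart u e)) z :=
  dz_dzbar_comm e.open_target hu hz

lemma hessMat_isHermitian (hz : z ∈ e.target) : (hessMat u e z).IsHermitian := by
  ext j k
  change conj (hess u e k j z) = hess u e j k z
  rw [hess, ← dzbar_conj (differentiableAt_dzbar hu hz j), hess_eq hu hz]
  refine dzbar_congr ?_
  filter_upwards [e.open_target.mem_nhds hz] with w hw
  exact conj_dzbar hu hw j

lemma dz_hess_comm (hz : z ∈ e.target) (i j k : Fin n) :
    dz i (hess u e j k) z = dz j (hess u e i k) z :=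
  dz_dz_comm e.open_target (contDiffOn_dzbar e.open_target hu) hz

lemma dzbar_hess_comm (hz : z ∈ e.target) (i j k : Fin n) :
    dzbar i (hess u e j k) z = dzbar k (hess u e j i) z := by
  have h : ∀ i k, dzbar i (hess u e j k) z = dzbar i (dzbar k (dz j (inChart u e))) z := by
    intro i k
    refine dzbar_congr ?_
    filter_upwards [e.open_target.mem_nhds hz] with w hw
    exact hess_eq hu hw j k
  rw [h, h, dzbar_dzbar_comm e.open_target (contDiffOn_dz e.open_target hu) hz]

end RealFunctions

variable {n : ℕ} {X : Type*} [TopologicalSpace X] [ChartedSpace (Fin n → ℂ) X]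
  {g : KahlerMetric n X} {e : OpenPartialHomeomorph X (Fin n → ℂ)} {z : Fin n → ℂ}
  {u v : X → ℝ}

/-- The sesquilinear pairing `⟨∂u, ∂v⟩ = g^{j\bar k} u_j v_{\bar k}` in the chart `e`. -/
noncomputable def chartPairing (g : KahlerMetric n X) (e : OpenPartialHomeomorph X (Fin n → ℂ))
    (u v : X → ℝ) (z : Fin n → ℂ) : ℂ :=
  ∑ j, ∑ k, metricInv g e j k z * dz j (inChart u e) z * dzbar k (inChart v e) z

/-- The Laplacian `g^{j\bar k} u_{j\bar k}` in the chart `e`. -/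
noncomputable def chartLaplacian (g : KahlerMetric n X)
    (e : OpenPartialHomeomorph X (Fin n → ℂ)) (u : X → ℝ) (z : Fin n → ℂ) : ℂ :=
  ∑ j, ∑ k, metricInv g e j k z * hess u e j k z

/-- The covariant Hessian of type `(2, 0)`, `∇_i ∇_j u = ∂_i ∂_j u - Γ^p_{ij} ∂_p u`. -/
noncomputable def covHess (g : KahlerMetric n X) (u : X → ℝ)
    (e : OpenPartialHomeomorph X (Fin n → ℂ)) (i j : Fin n) (z : Fin n → ℂ) : ℂ :=
  dz i (dz j (inChart u e)) z - ∑ p, christoffel g e p i j z * dz p (inChart u e) z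

lemma sum_metricInv_mul_eq_trace (A : Matrix (Fin n) (Fin n) ℂ) :
    ∑ j, ∑ k, metricInv g e j k z * A j k = ((metric g e z)⁻¹ * A).trace := by
  simp only [Matrix.trace, Matrix.diag, Matrix.mul_apply, metricInv]
  exact Finset.sum_comm

lemma chartLaplacian_eq_trace :
    chartLaplacian g e u z = ((metric g e z)⁻¹ * hessMat u e z).trace :=
  sum_metricInv_mul_eq_trace (hessMat u e z)

lemma gradUp_eq (j : Fin n) :
    gradUp g u e j z = ((fun k => dzbar k (inChart u e) z) ᵥ* (metric g e z)⁻¹) j := by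
  simp only [gradUp, Matrix.vecMul, dotProduct, metricInv, mul_comm]

lemma chartPairing_eq_sum_gradUp :
    chartPairing g e u v z = ∑ j, gradUp g v e j z * dz j (inChart u e) z := by
  simp only [chartPairing, gradUp, Finset.sum_mul]
  exact Finset.sum_congr rfl fun j _ => Finset.sum_congr rfl fun k _ => by ring

lemma chartPairing_eq_sum_gradUpBar :
    chartPairing g e u v z = ∑ k, dzbar k (inChart v e) z * gradUpBar g u e k z := by
  simp only [chartPairing, gradUpBar, Finset.mul_sum]
  rw [Finset.sum_comm]
  exact Finset.sum_congr rfl fun j _ => Finset.sum_congr rfl fun k _ => by ring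

lemma chartPairing_eq_dotProduct :
    chartPairing g e u v z = (fun k => dzbar k (inChart v e) z) ⬝ᵥ
      (metric g e z)⁻¹ *ᵥ fun j => dz j (inChart u e) z :=
  chartPairing_eq_sum_gradUpBar

section Smooth

variable (hu : ContDiffOn ℝ ∞ (inChart u e) e.target)

include hu

variable [IsManifold 𝓘(ℂ, Fin n → ℂ) ω X] (he : e ∈ atlas (Fin n → ℂ) X)

include he

lemma contDiffOn_gradUp (j : Fin n) : ContDiffOn ℝ ∞ (gradUp g u e j) e.target :=
  ContDiffOn.sum fun k _ => (contDiffOn_metricInv he j k).mul (contDiffOn_dzbar e.open_target hu)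

lemma contDiffOn_gradUpBar (k : Fin n) : ContDiffOn ℝ ∞ (gradUpBar g u e k) e.target :=
  ContDiffOn.sum fun j _ => (contDiffOn_metricInv he j k).mul (contDiffOn_dz e.open_target hu)

lemma contDiffOn_covHess (i j : Fin n) : ContDiffOn ℝ ∞ (covHess g u e i j) e.target :=
  (contDiffOn_dz e.open_target (contDiffOn_dz e.open_target hu)).sub <|
    ContDiffOn.sum fun p _ => (contDiffOn_christoffel he p i j).mul
      (contDiffOn_dz e.open_target hu)

lemma contDiffOn_chartLaplacian : ContDiffOn ℝ ∞ (chartLaplacian g e u) e.target :=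
  ContDiffOn.sum fun j _ => ContDiffOn.sum fun k _ =>
    (contDiffOn_metricInv he j k).mul (contDiffOn_hess hu j k)

lemma contDiffOn_chartPairing (hv : ContDiffOn ℝ ∞ (inChart v e) e.target) :
    ContDiffOn ℝ ∞ (chartPairing g e u v) e.target :=
  ContDiffOn.sum fun j _ => ContDiffOn.sum fun k _ =>
    ((contDiffOn_metricInv he j k).mul (contDiffOn_dz e.open_target hu)).mul
      (contDiffOn_dzbar e.open_target hv)

omit hu in
lemma sum_metric_mul_gradUpBar (hz : z ∈ e.target) (j : Fin n) :
    ∑ k, metric g e z j k * gradUpBar g u e k z = dz j (inChart u e) z := by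
  have h : metric g e z *ᵥ ((metric g e z)⁻¹ *ᵥ fun j => dz j (inChart u e) z)
      = fun j => dz j (inChart u e) z := by
    rw [Matrix.mulVec_mulVec, metric_mul_inv he hz, Matrix.one_mulVec]
  exact congrFun h j

omit hu in
lemma sum_gradUp_mul_metric (hz : z ∈ e.target) (k : Fin n) :
    ∑ j, gradUp g u e j z * metric g e z j k = dzbar k (inChart u e) z := by
  have h : ((fun k => dzbar k (inChart u e) z) ᵥ* (metric g e z)⁻¹) ᵥ* metric g e z
      = fun k => dzbar k (inChart u e) z := by
    rw [Matrix.vecMul_vecMul, inv_mul_metric he hz, Matrix.vecMul_one]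
  simp only [gradUp_eq]
  exact congrFun h k

lemma conj_gradUpBar (hz : z ∈ e.target) (k : Fin n) :
    conj (gradUpBar g u e k z) = gradUp g u e k z := by
  simp only [gradUpBar, gradUp, map_sum, map_mul, conj_dz hu hz]
  refine Finset.sum_congr rfl fun j _ => ?_
  congr 1
  exact (metric_posDef he hz).inv.isHermitian.apply j k

omit hu in
lemma covHess_eq (hz : z ∈ e.target) (i j : Fin n) :
    covHess g u e i j z = dz i (dz j (inChart u e)) z
      - ∑ q, dz i (fun w => metric g e w j q) z * gradUpBar g u e q z := by
  rw [covHess]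
  congr 1
  simp only [← sum_christoffel_mul_metric he hz, Finset.sum_mul]
  rw [Finset.sum_comm]
  refine Finset.sum_congr rfl fun p _ => ?_
  rw [← sum_metric_mul_gradUpBar he hz p, Finset.mul_sum]
  exact Finset.sum_congr rfl fun q _ => by ring

lemma sum_dz_gradUp_mul_metric (hz : z ∈ e.target) (i k : Fin n) :
    ∑ j, dz i (gradUp g u e j) z * metric g e z j k
      = hess u e i k z - ∑ j, gradUp g u e j z * dz i (fun w => metric g e w j k) z := by
  have hy := fun j => differentiableAt_of_contDiffOn e.open_target
    (contDiffOn_gradUp (g := g) hu he j) hz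
  have h2 : dz i (fun w => ∑ j, gradUp g u e j w * metric g e w j k) z = hess u e i k z := by
    refine dz_congr ?_
    filter_upwards [e.open_target.mem_nhds hz] with w hw
    exact sum_gradUp_mul_metric he hw k
  rw [dz_sum _ fun j _ => (hy j).fun_mul (differentiableAt_metric he hz j k)] at h2
  simp only [dz_mul (hy _) (differentiableAt_metric he hz _ k), Finset.sum_add_distrib] at h2
  exact eq_sub_of_add_eq h2

/-- `∂_i ∇^j u` in terms of the complex Hessian and the derivatives `∂_q g_{i\bar k}`; the Kähler
condition is used to write `∂_i g_{q\bar k}` as `∂_q g_{i\bar k}`. -/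
lemma dz_gradUp (hz : z ∈ e.target) :
    (Matrix.of fun i j => dz i (gradUp g u e j) z)
      = (hessMat u e z - ∑ q, gradUp g u e q z • dzMat q (metric g e) z)
        * (metric g e z)⁻¹ := by
  have h1 : (Matrix.of fun i j => dz i (gradUp g u e j) z) * metric g e z
      = hessMat u e z - ∑ q, gradUp g u e q z • dzMat q (metric g e) z := by
    ext i k
    simp only [Matrix.mul_apply, Matrix.of_apply, sum_dz_gradUp_mul_metric hu he hz, hessMat,
      Matrix.sub_apply, Matrix.sum_apply, Matrix.smul_apply, dzMat, smul_eq_mul,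
      dz_metric_comm he hz i]
  rw [← h1, Matrix.mul_assoc, metric_mul_inv he hz, Matrix.mul_one]

/-- `∂_i |∇u|² = u_{i\bar k} ∇^{\bar k} u + ∇_i ∇_j u ∇^j u`. -/
lemma dz_chartPairing_self (hz : z ∈ e.target) (i : Fin n) :
    dz i (chartPairing g e u u) z = ∑ k, hess u e i k z * gradUpBar g u e k z
      + ∑ j, covHess g u e i j z * gradUp g u e j z := by
  have hy := fun j => differentiableAt_of_contDiffOn e.open_target
    (contDiffOn_gradUp (g := g) hu he j) hz
  have h3 : chartPairing g e u u = fun w => ∑ j, gradUp g u e j w * dz j (inChart u e) w :=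
    funext fun w => chartPairing_eq_sum_gradUp
  have h4 : ∑ j, dz i (gradUp g u e j) z * dz j (inChart u e) z
      = ∑ k, (∑ j, dz i (gradUp g u e j) z * metric g e z j k) * gradUpBar g u e k z := by
    simp only [Finset.sum_mul]
    rw [Finset.sum_comm]
    refine Finset.sum_congr rfl fun j _ => ?_
    rw [← sum_metric_mul_gradUpBar he hz j, Finset.mul_sum]
    exact Finset.sum_congr rfl fun k _ => by ring
  rw [h3, dz_sum _ fun j _ => (hy j).fun_mul (differentiableAt_dz hu hz j)]
  simp only [dz_mul (hy _) (differentiableAt_dz hu hz _), Finset.sum_add_distrib]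
  rw [h4]
  simp only [sum_dz_gradUp_mul_metric hu he hz, covHess_eq he hz, sub_mul, Finset.sum_sub_distrib,
    Finset.sum_mul]
  rw [Finset.sum_comm (f := fun k j => gradUp g u e j z * _ * _), sub_add_eq_add_sub,
    add_sub_assoc]
  congr 1
  congr 1
  · exact Finset.sum_congr rfl fun j _ => mul_comm _ _
  · exact Finset.sum_congr rfl fun j _ => Finset.sum_congr rfl fun k _ => by ring

/-- `∇_{\bar l} ∇^j u = g^{j\bar k} ∇_{\bar l} ∇_{\bar k} u`, the last factor being the conjugate
of the covariant Hessian. -/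
lemma dzbar_gradUp (hz : z ∈ e.target) :
    (Matrix.of fun j l => dzbar l (gradUp g u e j) z)
      = ((metric g e z)⁻¹)ᵀ * (Matrix.of fun i j => covHess g u e i j z)ᴴ := by
  have hy := fun j => differentiableAt_of_contDiffOn e.open_target
    (contDiffOn_gradUp (g := g) hu he j) hz
  have h1 : (metric g e z)ᵀ * (Matrix.of fun j l => dzbar l (gradUp g u e j) z)
      = (Matrix.of fun i j => covHess g u e i j z)ᴴ := by
    ext k l
    have h2 : dzbar l (fun w => ∑ j, gradUp g u e j w * metric g e w j k) z
        = dzbar l (dzbar k (inChart u e)) z := by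
      refine dzbar_congr ?_
      filter_upwards [e.open_target.mem_nhds hz] with w hw
      exact sum_gradUp_mul_metric he hw k
    have h5 : conj (dz l (dz k (inChart u e)) z) = dzbar l (dzbar k (inChart u e)) z := by
      rw [← dzbar_conj (differentiableAt_dz hu hz k)]
      refine dzbar_congr ?_
      filter_upwards [e.open_target.mem_nhds hz] with w hw
      exact conj_dz hu hw k
    rw [dzbar_sum _ fun j _ => (hy j).fun_mul (differentiableAt_metric he hz j k)] at h2
    simp only [dzbar_mul (hy _) (differentiableAt_metric he hz _ k),
      Finset.sum_add_distrib] at h2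
    simp only [Matrix.mul_apply, Matrix.transpose_apply, Matrix.conjTranspose_apply,
      Matrix.of_apply, covHess_eq he hz, star_sub, star_sum, star_mul']
    simp only [Complex.star_def, h5, conj_gradUpBar hu he hz, ← dzbar_metric_eq he hz, ← h2]
    simp only [mul_comm, add_sub_cancel_right]
  rw [← h1, ← Matrix.mul_assoc, ← Matrix.transpose_mul, metric_mul_inv he hz,
    Matrix.transpose_one, Matrix.one_mul]

lemma dzbar_gradUpBar (hz : z ∈ e.target) :
    (Matrix.of fun k l => dzbar l (gradUpBar g u e k) z)
      = (metric g e z)⁻¹ * (hessMat u e z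
        - ∑ q, gradUpBar g u e q z • dzbarMat q (metric g e) z) := by
  have hx := fun k => differentiableAt_of_contDiffOn e.open_target
    (contDiffOn_gradUpBar (g := g) hu he k) hz
  have h1 : metric g e z * (Matrix.of fun k l => dzbar l (gradUpBar g u e k) z)
      = hessMat u e z - ∑ q, gradUpBar g u e q z • dzbarMat q (metric g e) z := by
    ext j l
    have h2 : dzbar l (fun w => ∑ k, metric g e w j k * gradUpBar g u e k w) z
        = hess u e j l z := by
      rw [hess_eq hu hz]
      refine dzbar_congr ?_
      filter_upwards [e.open_target.mem_nhds hz] with w hw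
      exact sum_metric_mul_gradUpBar he hw j
    rw [dzbar_sum _ fun k _ => (differentiableAt_metric he hz j k).fun_mul (hx k)] at h2
    simp only [dzbar_mul (differentiableAt_metric he hz j _) (hx _),
      Finset.sum_add_distrib] at h2
    simp only [Matrix.mul_apply, Matrix.of_apply, hessMat, Matrix.sub_apply, Matrix.sum_apply,
      Matrix.smul_apply, dzbarMat, smul_eq_mul, ← h2]
    simp only [dzbar_metric_comm he hz _ j l, mul_comm, add_sub_cancel_left]
  rw [← h1, ← Matrix.mul_assoc, inv_mul_metric he hz, Matrix.one_mul]

/-- The commutation of derivatives that brings in the curvature: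
`∇_{\bar l} ∇_i ∇_j u = ∇_j u_{i\bar l} + R_j{}^p{}_{i\bar l} u_p`. -/
lemma dzbar_covHess (hz : z ∈ e.target) (i j l : Fin n) :
    dzbar l (covHess g u e i j) z = dz j (hess u e i l) z
      - (dzMat j (metric g e) z * (metric g e z)⁻¹ * hessMat u e z) i l
      + ∑ p, dz p (inChart u e) z * curvature g e j p i l z := by
  have hΓ := fun p => differentiableAt_of_contDiffOn e.open_target
    (contDiffOn_christoffel (g := g) he p i j) hz
  have h1 : dzbar l (dz i (dz j (inChart u e))) z = dz j (hess u e i l) z := by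
    rw [← dz_dzbar_comm e.open_target (contDiffOn_dz e.open_target hu) hz, dz_hess_comm hu hz]
    refine dz_congr ?_
    filter_upwards [e.open_target.mem_nhds hz] with w hw
    exact (hess_eq hu hw j l).symm
  have h2 : dzbar l (covHess g u e i j) z = dzbar l (dz i (dz j (inChart u e))) z
      - dzbar l (fun w => ∑ p, christoffel g e p i j w * dz p (inChart u e) w) z :=
    dzbar_sub (differentiableAt_of_contDiffOn e.open_target
        (contDiffOn_dz e.open_target (contDiffOn_dz e.open_target hu)) hz)
      (.fun_sum fun p _ => (hΓ p).fun_mul (differentiableAt_dz hu hz p))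
  rw [h2, h1, dzbar_sum _ fun p _ => (hΓ p).fun_mul (differentiableAt_dz hu hz p)]
  simp only [dzbar_mul (hΓ _) (differentiableAt_dz hu hz _), Finset.sum_add_distrib,
    ← hess_eq hu hz, curvature, Matrix.mul_apply (M := dzMat j (metric g e) z * _),
    ← christoffel_eq_mul, hessMat, Matrix.of_apply, mul_neg, Finset.sum_neg_distrib]
  simp only [christoffel_comm he hz _ j i, mul_comm]
  ring

/-- The mixed second derivatives of `|∇u|²`. -/
lemma hess_chartPairing_self (hz : z ∈ e.target) :
    (Matrix.of fun i l => dz i (dzbar l (chartPairing g e u u)) z)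
      = ∑ q, gradUpBar g u e q z • dzbarMat q (hessMat u e) z
        + hessMat u e z * (Matrix.of fun k l => dzbar l (gradUpBar g u e k) z)
        + (∑ j, gradUp g u e j z • (dzMat j (hessMat u e) z
            - dzMat j (metric g e) z * (metric g e z)⁻¹ * hessMat u e z
            + ∑ p, dz p (inChart u e) z • Matrix.of fun i l => curvature g e j p i l z)
        + (Matrix.of fun i j => covHess g u e i j z)
            * (Matrix.of fun j l => dzbar l (gradUp g u e j) z)) := by
  have hx := fun k => differentiableAt_of_contDiffOn e.open_target
    (contDiffOn_gradUpBar (g := g) hu he k) hz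
  have hy := fun j => differentiableAt_of_contDiffOn e.open_target
    (contDiffOn_gradUp (g := g) hu he j) hz
  have hH := fun i k => differentiableAt_of_contDiffOn e.open_target (contDiffOn_hess hu i k) hz
  have hT := fun i j => differentiableAt_of_contDiffOn e.open_target
    (contDiffOn_covHess (g := g) hu he i j) hz
  ext i l
  have h1 : dzbar l (dz i (chartPairing g e u u)) z
      = dzbar l (fun w => ∑ k, hess u e i k w * gradUpBar g u e k w
        + ∑ j, covHess g u e i j w * gradUp g u e j w) z := by
    refine dzbar_congr ?_
    filter_upwards [e.open_target.mem_nhds hz] with w hw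
    exact dz_chartPairing_self hu he hw i
  rw [Matrix.of_apply, dz_dzbar_comm e.open_target (contDiffOn_chartPairing hu he hu) hz, h1,
    dzbar_add (.fun_sum fun k _ => (hH i k).fun_mul (hx k))
      (.fun_sum fun j _ => (hT i j).fun_mul (hy j)),
    dzbar_sum _ fun k _ => (hH i k).fun_mul (hx k),
    dzbar_sum _ fun j _ => (hT i j).fun_mul (hy j)]
  simp only [dzbar_mul (hH i _) (hx _), dzbar_mul (hT i _) (hy _), Finset.sum_add_distrib,
    Matrix.add_apply, Matrix.sum_apply, Matrix.smul_apply, smul_eq_mul, Matrix.sub_apply]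
  congr 1
  · congr 1
    exact Finset.sum_congr rfl fun q _ => by
      rw [dzbar_hess_comm hu hz, mul_comm]; rfl
  · congr 1
    exact Finset.sum_congr rfl fun j _ => by
      rw [dzbar_covHess hu he hz, mul_comm]; rfl

lemma dz_chartLaplacian (hz : z ∈ e.target) (j : Fin n) :
    dz j (chartLaplacian g e u) z = ((metric g e z)⁻¹ * dzMat j (hessMat u e) z).trace
      - ((metric g e z)⁻¹ * (dzMat j (metric g e) z * (metric g e z)⁻¹ * hessMat u e z)).trace := by
  have hH : ∀ i k, DifferentiableAt ℝ (fun w => hessMat u e w i k) z := fun i k =>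
    differentiableAt_of_contDiffOn e.open_target (contDiffOn_hess hu i k) hz
  have h : dz j (chartLaplacian g e u) z
      = (dzMat j (fun w => (metric g e w)⁻¹ * hessMat u e w) z).trace := by
    have h1 : chartLaplacian g e u
        = fun w => ∑ i, ((metric g e w)⁻¹ * hessMat u e w) i i :=
      funext fun w => chartLaplacian_eq_trace
    rw [h1, dz_sum]
    · rfl
    · intro i _
      simp only [Matrix.mul_apply]
      exact .fun_sum fun k _ => (differentiableAt_metric_inv he hz i k).fun_mul (hH k i)
  rw [h, dzMat_mul (differentiableAt_metric_inv he hz) hH, dzMat_metric_inv he hz,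
    Matrix.trace_add, add_comm, Matrix.neg_mul, Matrix.trace_neg, ← sub_eq_add_neg]
  simp only [Matrix.mul_assoc]

lemma dzbar_chartLaplacian (hz : z ∈ e.target) (j : Fin n) :
    dzbar j (chartLaplacian g e u) z = ((metric g e z)⁻¹ * dzbarMat j (hessMat u e) z).trace
      - ((metric g e z)⁻¹ * (hessMat u e z * ((metric g e z)⁻¹
        * dzbarMat j (metric g e) z))).trace := by
  have hH : ∀ i k, DifferentiableAt ℝ (fun w => hessMat u e w i k) z := fun i k =>
    differentiableAt_of_contDiffOn e.open_target (contDiffOn_hess hu i k) hz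
  have h : dzbar j (chartLaplacian g e u) z
      = (dzbarMat j (fun w => (metric g e w)⁻¹ * hessMat u e w) z).trace := by
    have h1 : chartLaplacian g e u
        = fun w => ∑ i, ((metric g e w)⁻¹ * hessMat u e w) i i :=
      funext fun w => chartLaplacian_eq_trace
    rw [h1, dzbar_sum]
    · rfl
    · intro i _
      simp only [Matrix.mul_apply]
      exact .fun_sum fun k _ => (differentiableAt_metric_inv he hz i k).fun_mul (hH k i)
  rw [h, dzbarMat_mul (differentiableAt_metric_inv he hz) hH, dzbarMat_metric_inv he hz,
    Matrix.trace_add, add_comm, Matrix.neg_mul, Matrix.trace_neg, ← sub_eq_add_neg]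
  congr 1
  have h2 := Matrix.trace_mul_comm ((metric g e z)⁻¹ * dzbarMat j (metric g e) z)
    ((metric g e z)⁻¹ * hessMat u e z)
  simpa only [Matrix.mul_assoc] using h2

/-- **Bochner formula**: `Δ|∇u|² = |∇∇u|² + |∇∇̄u|² + 2 Re ⟨∂Δu, ∂u⟩ + Ric(∇u, ∇u)`. -/
theorem chart_bochner (hz : z ∈ e.target) :
    ∑ j, ∑ k, metricInv g e j k z * dz j (dzbar k (chartPairing g e u u)) z
      = ((metric g e z)⁻¹ * (Matrix.of fun i j => covHess g u e i j z) * ((metric g e z)⁻¹)ᵀ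
          * (Matrix.of fun i j => covHess g u e i j z)ᴴ).trace
        + ((metric g e z)⁻¹ * hessMat u e z * (metric g e z)⁻¹ * hessMat u e z).trace
        + ∑ q, gradUpBar g u e q z * dzbar q (chartLaplacian g e u) z
        + ∑ j, gradUp g u e j z * dz j (chartLaplacian g e u) z
        + ∑ j, ∑ q, ricci g e j q z * gradUp g u e j z * gradUpBar g u e q z := by
  have hR : ∀ j, ∑ p, dz p (inChart u e) z
        * ((metric g e z)⁻¹ * Matrix.of fun i l => curvature g e j p i l z).trace
      = ∑ q, ricci g e j q z * gradUpBar g u e q z := by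
    intro j
    simp only [← sum_metricInv_mul_eq_trace, metricInv, Matrix.of_apply,
      sum_inv_mul_curvature he hz, gradUpBar, Finset.mul_sum]
    rw [Finset.sum_comm]
    exact Finset.sum_congr rfl fun q _ => Finset.sum_congr rfl fun p _ => by ring
  have h0 := sum_metricInv_mul_eq_trace (g := g) (e := e) (z := z)
    (Matrix.of fun i l => dz i (dzbar l (chartPairing g e u u)) z)
  simp only [Matrix.of_apply] at h0
  rw [h0, hess_chartPairing_self hu he hz, dzbar_gradUp hu he hz, dzbar_gradUpBar hu he hz]
  simp only [Matrix.mul_smul, Matrix.trace_add,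
    Matrix.trace_sub, Matrix.trace_sum, Matrix.trace_smul, smul_eq_mul, hR,
    dz_chartLaplacian hu he hz, dzbar_chartLaplacian hu he hz, mul_add, mul_sub,
    Finset.sum_add_distrib, Finset.sum_sub_distrib, Finset.mul_sum]
  simp only [Matrix.mul_assoc]
  have h5 : ∑ j, ∑ q, gradUp g u e j z * (ricci g e j q z * gradUpBar g u e q z)
      = ∑ j, ∑ q, ricci g e j q z * gradUp g u e j z * gradUpBar g u e q z :=
    Finset.sum_congr rfl fun j _ => Finset.sum_congr rfl fun q _ => by ring
  rw [h5]
  ring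

end Smooth

end Bochner

/-! ### Independence of the chart -/

section ChartChange

open Filter Topology ComplexConjugate
open scoped ComplexOrder

variable {n : ℕ} {X : Type*} [TopologicalSpace X] [ChartedSpace (Fin n → ℂ) X]
  {g : KahlerMetric n X} {e e' : OpenPartialHomeomorph X (Fin n → ℂ)} {z : Fin n → ℂ}
  {u v : X → ℝ}

/-- The Jacobian matrix `∂φ^a/∂z^i` (row `i`, column `a`) of the coordinate change
`φ = e' ∘ e⁻¹`. -/
noncomputable def jacobian (e e' : OpenPartialHomeomorph X (Fin n → ℂ)) (z : Fin n → ℂ) :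
    Matrix (Fin n) (Fin n) ℂ :=
  Matrix.of fun i a => fderiv ℂ (e' ∘ e.symm) z (Pi.single i 1) a

omit [ChartedSpace (Fin n → ℂ) X] in
lemma mem_trans_source_iff :
    z ∈ (e.symm.trans e').source ↔ z ∈ e.target ∧ e.symm z ∈ e'.source := by
  simp

omit [ChartedSpace (Fin n → ℂ) X] in
lemma inChart_eq_comp (hz : z ∈ (e.symm.trans e').source) :
    inChart u e z = inChart u e' (e' (e.symm z)) := by
  rw [inChart, inChart, e'.left_inv (mem_trans_source_iff.1 hz).2]

variable [IsManifold 𝓘(ℂ, Fin n → ℂ) ω X] (he : e ∈ atlas (Fin n → ℂ) X)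
  (he' : e' ∈ atlas (Fin n → ℂ) X) (hz : z ∈ (e.symm.trans e').source)

include he he'

lemma contDiffOn_coordChange :
    ContDiffOn ℂ ω (e' ∘ e.symm) (e.symm.trans e').source := by
  have h := HasGroupoid.compatible (G := contDiffGroupoid ω 𝓘(ℂ, Fin n → ℂ)) he he'
  rw [contDiffGroupoid, mem_groupoid_of_pregroupoid] at h
  simpa [contDiffPregroupoid, Function.comp_def] using h.1

lemma differentiableAt_coordChange (hz : z ∈ (e.symm.trans e').source) :
    DifferentiableAt ℂ (e' ∘ e.symm) z :=
  ((contDiffOn_coordChange he he').contDiffAt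
    ((e.symm.trans e').open_source.mem_nhds hz)).differentiableAt (by simp)

lemma differentiableAt_jacobian (hz : z ∈ (e.symm.trans e').source) (i a : Fin n) :
    DifferentiableAt ℂ (fun w => jacobian e e' w i a) z := by
  have h : DifferentiableAt ℂ (fderiv ℂ (e' ∘ e.symm)) z :=
    (((contDiffOn_coordChange he he').contDiffAt
      ((e.symm.trans e').open_source.mem_nhds hz)).fderiv_right (m := 1)
        (by simp)).differentiableAt (by simp)
  exact differentiableAt_pi.1 (h.clm_apply (differentiableAt_const _)) a

include hz

/-- The coordinate vectors transform by the Jacobian matrix: `∂/∂zⁱ = ∂φ^a/∂zⁱ ∂/∂w^a`. -/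
lemma coordVec_eq_sum (i : Fin n) :
    (coordVec e z i : Fin n → ℂ)
      = ∑ a, jacobian e e' z i a • (coordVec e' (e' (e.symm z)) a : Fin n → ℂ) := by
  have hM : IsManifold 𝓘(ℂ, Fin n → ℂ) 1 X := .of_le (n := ω) (by simp)
  obtain ⟨hz1, hz2⟩ := mem_trans_source_iff.1 hz
  have h1 : e.symm =ᶠ[𝓝 z] e'.symm ∘ (e' ∘ e.symm) := by
    filter_upwards [(e.symm.trans e').open_source.mem_nhds hz] with w hw
    exact (e'.left_inv (mem_trans_source_iff.1 hw).2).symm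
  have h2 : MDifferentiableAt 𝓘(ℂ, Fin n → ℂ) 𝓘(ℂ, Fin n → ℂ) (e' ∘ e.symm) z :=
    (differentiableAt_coordChange he he' hz).mdifferentiableAt
  have h3 : MDifferentiableAt 𝓘(ℂ, Fin n → ℂ) 𝓘(ℂ, Fin n → ℂ) e'.symm ((e' ∘ e.symm) z) :=
    mdifferentiableAt_atlas_symm he' (e'.map_source hz2)
  have h4 := h1.mfderiv_eq (I := 𝓘(ℂ, Fin n → ℂ)) (I' := 𝓘(ℂ, Fin n → ℂ))
  rw [mfderiv_comp z h3 h2, mfderiv_eq_fderiv] at h4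
  have h5 := coordVec_eq e' (e' (e.symm z)) (fderiv ℂ (e' ∘ e.symm) z (Pi.single i 1))
  refine Eq.trans ?_ h5
  exact congrArg (fun A : (Fin n → ℂ) →L[ℂ] (Fin n → ℂ) => A (Pi.single i 1)) h4

lemma metric_eq_mul :
    metric g e z = jacobian e e' z * metric g e' (e' (e.symm z)) * (jacobian e e' z)ᴴ := by
  obtain ⟨hz1, hz2⟩ := mem_trans_source_iff.1 hz
  have hform : ∀ {x y : X} (_ : x = y) (v w : Fin n → ℂ), g.form x v w = g.form y v w := by
    rintro x _ rfl v w; rfl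
  ext i j
  have h1 : metric g e z i j = g.form (e'.symm (e' (e.symm z)))
      (coordVec e z i : Fin n → ℂ) (coordVec e z j : Fin n → ℂ) :=
    hform (e'.left_inv hz2).symm _ _
  rw [h1, coordVec_eq_sum he he' hz, coordVec_eq_sum he he' hz]
  refine (form_sum_smul _ _ _ _).trans ?_
  simp only [Matrix.mul_apply, Matrix.conjTranspose_apply, Finset.sum_mul]
  rw [Finset.sum_comm]
  refine Finset.sum_congr rfl fun b _ => Finset.sum_congr rfl fun a _ => ?_
  simp only [metric, formCoeff, Matrix.of_apply, Complex.star_def]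
  ring

lemma jacobian_isUnit_det (g : KahlerMetric n X) : IsUnit (jacobian e e' z).det := by
  have h := metric_det_ne_zero (g := g) he (mem_trans_source_iff.1 hz).1
  rw [metric_eq_mul he he' hz, Matrix.det_mul, Matrix.det_mul] at h
  exact (left_ne_zero_of_mul (left_ne_zero_of_mul h)).isUnit

lemma jacobian_conjTranspose_isUnit_det (g : KahlerMetric n X) :
    IsUnit ((jacobian e e' z)ᴴ).det := by
  rw [Matrix.det_conjTranspose]
  exact (jacobian_isUnit_det he he' hz g).star

lemma dz_inChart_eq (hu : ContDiffOn ℝ ∞ (inChart u e') e'.target) :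
    (fun i => dz i (inChart u e) z)
      = jacobian e e' z *ᵥ fun a => dz a (inChart u e') (e' (e.symm z)) := by
  ext i
  have h : inChart u e =ᶠ[𝓝 z] fun w => inChart u e' ((e' ∘ e.symm) w) := by
    filter_upwards [(e.symm.trans e').open_source.mem_nhds hz] with w hw
    exact inChart_eq_comp hw
  rw [dz_congr h, dz_comp_holomorphic (differentiableAt_coordChange he he' hz)
    (differentiableAt_of_contDiffOn e'.open_target hu
      (e'.map_source (mem_trans_source_iff.1 hz).2))]
  rfl

lemma dzbar_inChart_eq (hu : ContDiffOn ℝ ∞ (inChart u e') e'.target) :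
    (fun i => dzbar i (inChart u e) z)
      = (fun a => dzbar a (inChart u e') (e' (e.symm z))) ᵥ* (jacobian e e' z)ᴴ := by
  ext i
  have h : inChart u e =ᶠ[𝓝 z] fun w => inChart u e' ((e' ∘ e.symm) w) := by
    filter_upwards [(e.symm.trans e').open_source.mem_nhds hz] with w hw
    exact inChart_eq_comp hw
  rw [dzbar_congr h, dzbar_comp_holomorphic (differentiableAt_coordChange he he' hz)
    (differentiableAt_of_contDiffOn e'.open_target hu
      (e'.map_source (mem_trans_source_iff.1 hz).2))]
  exact Finset.sum_congr rfl fun a _ => mul_comm _ _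

/-- The complex Hessian transforms as a tensor because the antiholomorphic factor `conj ∂φ` is
annihilated by `∂_j`. -/
lemma hessMat_eq_mul (hu : ContDiffOn ℝ ∞ (inChart u e') e'.target) :
    hessMat u e z = jacobian e e' z * hessMat u e' (e' (e.symm z)) * (jacobian e e' z)ᴴ := by
  ext j k
  have hz' := e'.map_source (mem_trans_source_iff.1 hz).2
  have h : dzbar k (inChart u e) =ᶠ[𝓝 z] fun w => ∑ b, dzbar b (inChart u e') ((e' ∘ e.symm) w)
      * conj (jacobian e e' w k b) := by
    filter_upwards [(e.symm.trans e').open_source.mem_nhds hz] with w hw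
    exact congrFun (dzbar_inChart_eq he he' hw hu) k
  have hJ := fun b => differentiableAt_jacobian he he' hz k b
  have hJc : ∀ b, DifferentiableAt ℝ (fun w => conj (jacobian e e' w k b)) z := fun b =>
    Complex.conjCLE.differentiableAt.comp z ((hJ b).restrictScalars ℝ)
  have hφ := differentiableAt_coordChange he he' hz
  have hd : ∀ b, DifferentiableAt ℝ (dzbar b (inChart u e')) ((e' ∘ e.symm) z) := fun b =>
    differentiableAt_dzbar hu hz' b
  have hdc : ∀ b, DifferentiableAt ℝ (fun w => dzbar b (inChart u e') ((e' ∘ e.symm) w)) z :=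
    fun b => (hd b).comp z (hφ.restrictScalars ℝ)
  change dz j (dzbar k (inChart u e)) z = _
  rw [dz_congr h, dz_sum _ fun b _ => (hdc b).fun_mul (hJc b)]
  simp only [Matrix.mul_apply, Matrix.conjTranspose_apply]
  refine Finset.sum_congr rfl fun b _ => ?_
  rw [dz_mul (hdc b) (hJc b), dz_conj ((hJ b).restrictScalars ℝ), dzbar_of_holomorphic (hJ b),
    dz_comp_holomorphic hφ (hd b), map_zero, mul_zero, add_zero]
  rfl

omit he he' hz in
lemma metric_inv_eq_mul (he : e ∈ atlas (Fin n → ℂ) X) (he' : e' ∈ atlas (Fin n → ℂ) X)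
    (hz : z ∈ (e.symm.trans e').source) :
    (metric g e z)⁻¹ = ((jacobian e e' z)ᴴ)⁻¹ * (metric g e' (e' (e.symm z)))⁻¹
      * (jacobian e e' z)⁻¹ := by
  rw [metric_eq_mul he he' hz, Matrix.mul_inv_rev, Matrix.mul_inv_rev, Matrix.mul_assoc]

lemma gradUpBar_vec_eq (hu : ContDiffOn ℝ ∞ (inChart u e') e'.target) :
    (metric g e z)⁻¹ *ᵥ (fun i => dz i (inChart u e) z)
      = ((jacobian e e' z)ᴴ)⁻¹ *ᵥ ((metric g e' (e' (e.symm z)))⁻¹ *ᵥ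
          fun a => dz a (inChart u e') (e' (e.symm z))) := by
  rw [metric_inv_eq_mul he he' hz, dz_inChart_eq he he' hz hu, Matrix.mulVec_mulVec,
    Matrix.mul_assoc, Matrix.nonsing_inv_mul _ (jacobian_isUnit_det he he' hz g), Matrix.mul_one,
    ← Matrix.mulVec_mulVec]

lemma gradUp_vec_eq (hu : ContDiffOn ℝ ∞ (inChart u e') e'.target) :
    (fun i => dzbar i (inChart u e) z) ᵥ* (metric g e z)⁻¹
      = ((fun a => dzbar a (inChart u e') (e' (e.symm z))) ᵥ*
          (metric g e' (e' (e.symm z)))⁻¹) ᵥ* (jacobian e e' z)⁻¹ := by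
  have hJ := jacobian_conjTranspose_isUnit_det he he' hz g
  rw [metric_inv_eq_mul he he' hz, dzbar_inChart_eq he he' hz hu, Matrix.vecMul_vecMul,
    ← Matrix.mul_assoc, ← Matrix.mul_assoc, Matrix.mul_nonsing_inv _ hJ, Matrix.one_mul,
    ← Matrix.vecMul_vecMul]

lemma chartPairing_coordChange (hu : ContDiffOn ℝ ∞ (inChart u e') e'.target)
    (hv : ContDiffOn ℝ ∞ (inChart v e') e'.target) :
    chartPairing g e u v z = chartPairing g e' u v (e' (e.symm z)) := by
  have hJ := jacobian_conjTranspose_isUnit_det he he' hz g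
  rw [chartPairing_eq_dotProduct, chartPairing_eq_dotProduct, gradUpBar_vec_eq he he' hz hu,
    dzbar_inChart_eq he he' hz hv, ← Matrix.dotProduct_mulVec, Matrix.mulVec_mulVec,
    Matrix.mul_nonsing_inv _ hJ, Matrix.one_mulVec]

lemma chartLaplacian_coordChange (hu : ContDiffOn ℝ ∞ (inChart u e') e'.target) :
    chartLaplacian g e u z = chartLaplacian g e' u (e' (e.symm z)) := by
  have hJ := jacobian_conjTranspose_isUnit_det he he' hz g
  rw [chartLaplacian_eq_trace, chartLaplacian_eq_trace, metric_inv_eq_mul he he' hz,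
    hessMat_eq_mul he he' hz hu, Matrix.mul_assoc, Matrix.mul_assoc, Matrix.trace_mul_comm]
  have h : (jacobian e e' z)⁻¹ * (jacobian e e' z * hessMat u e' (e' (e.symm z))
      * (jacobian e e' z)ᴴ) = hessMat u e' (e' (e.symm z)) * (jacobian e e' z)ᴴ := by
    rw [← Matrix.mul_assoc, ← Matrix.mul_assoc,
      Matrix.nonsing_inv_mul _ (jacobian_isUnit_det he he' hz g), Matrix.one_mul]
  rw [h, Matrix.mul_assoc, Matrix.mul_assoc, Matrix.mul_nonsing_inv _ hJ, Matrix.mul_one]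

/-- `u_{j\bar k} ∇^j u ∇^{\bar k} u` in the chart `e`. -/
noncomputable def chartHessGradGrad (g : KahlerMetric n X)
    (e : OpenPartialHomeomorph X (Fin n → ℂ)) (u : X → ℝ) (z : Fin n → ℂ) : ℂ :=
  ∑ j, ∑ k, hess u e j k z * gradUp g u e j z * gradUpBar g u e k z

omit he he' hz [IsManifold 𝓘(ℂ, Fin n → ℂ) ω X] in
lemma chartHessGradGrad_eq_dotProduct :
    chartHessGradGrad g e u z = ((fun k => dzbar k (inChart u e) z) ᵥ* (metric g e z)⁻¹) ⬝ᵥ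
      hessMat u e z *ᵥ ((metric g e z)⁻¹ *ᵥ fun j => dz j (inChart u e) z) := by
  rw [chartHessGradGrad, dotProduct]
  refine Finset.sum_congr rfl fun j _ => ?_
  rw [← gradUp_eq]
  change _ = gradUp g u e j z * ∑ k, hess u e j k z * gradUpBar g u e k z
  rw [Finset.mul_sum]
  exact Finset.sum_congr rfl fun k _ => by ring

lemma chartHessGradGrad_coordChange (hu : ContDiffOn ℝ ∞ (inChart u e') e'.target) :
    chartHessGradGrad g e u z = chartHessGradGrad g e' u (e' (e.symm z)) := by
  have hJ := jacobian_conjTranspose_isUnit_det he he' hz g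
  rw [chartHessGradGrad_eq_dotProduct, chartHessGradGrad_eq_dotProduct,
    gradUpBar_vec_eq he he' hz hu, gradUp_vec_eq he he' hz hu, hessMat_eq_mul he he' hz hu,
    ← Matrix.dotProduct_mulVec, Matrix.mulVec_mulVec, Matrix.mulVec_mulVec]
  have h : (jacobian e e' z)⁻¹ * (jacobian e e' z * hessMat u e' (e' (e.symm z))
      * (jacobian e e' z)ᴴ * ((jacobian e e' z)ᴴ)⁻¹) = hessMat u e' (e' (e.symm z)) := by
    rw [Matrix.mul_assoc, Matrix.mul_nonsing_inv _ hJ, Matrix.mul_one, ← Matrix.mul_assoc,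
      Matrix.nonsing_inv_mul _ (jacobian_isUnit_det he he' hz g), Matrix.one_mul]
  rw [Matrix.mul_assoc (jacobian e e' z)⁻¹, h]

end ChartChange

/-! ### The volume measure -/

section Volume

open Filter Topology
open scoped ComplexOrder

variable {n : ℕ} {X : Type*} [TopologicalSpace X] [ChartedSpace (Fin n → ℂ) X]
  {g : KahlerMetric n X} {e e' : OpenPartialHomeomorph X (Fin n → ℂ)} {z : Fin n → ℂ}

/-- The density `2ⁿ n! det(g_{i\bar j})` of `ωⁿ` with respect to Lebesgue measure. -/
noncomputable def chartDensity (g : KahlerMetric n X) (e : OpenPartialHomeomorph X (Fin n → ℂ))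
    (z : Fin n → ℂ) : ℝ :=
  2 ^ n * (n.factorial : ℝ) * (metric g e z).det.re

lemma continuousOn_chartDensity (he : e ∈ atlas (Fin n → ℂ) X) :
    ContinuousOn (chartDensity g e) e.target :=
  continuousOn_const.mul (Complex.continuous_re.comp_continuousOn
    (contDiffOn_metric_det he).continuousOn)

section

variable [MeasurableSpace X] [BorelSpace X]

omit [ChartedSpace (Fin n → ℂ) X] in
lemma aemeasurable_symm (e : OpenPartialHomeomorph X (Fin n → ℂ)) :
    AEMeasurable e.symm (volume.restrict e.target) :=
  e.continuousOn_symm.aemeasurable e.open_target.measurableSet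

omit [ChartedSpace (Fin n → ℂ) X] in
lemma measurableSet_symm_preimage_inter (e : OpenPartialHomeomorph X (Fin n → ℂ)) {s : Set X}
    (hs : MeasurableSet s) : MeasurableSet (e.symm ⁻¹' s ∩ e.target) := by
  have h : Measurable fun w : e.target => e.symm w :=
    (continuousOn_iff_continuous_domRestrict.1 e.continuousOn_symm).measurable
  have h2 := (e.open_target.measurableSet).subtype_image (h hs)
  convert h2 using 1
  ext w
  simp [and_comm]

lemma chartVolume_apply {s : Set X} (hs : MeasurableSet s) :
    chartVolume g e s
      = ∫⁻ w in e.symm ⁻¹' s ∩ e.target, ENNReal.ofReal (chartDensity g e w) := by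
  rw [chartVolume, Measure.map_apply_of_aemeasurable
    ((aemeasurable_symm e).mono_ac (withDensity_absolutelyContinuous _ _)) hs,
    withDensity_apply', Measure.restrict_restrict' e.open_target.measurableSet]
  rfl

lemma chartVolume_inter_source {s : Set X} (hs : MeasurableSet s) :
    chartVolume g e (s ∩ e.source) = chartVolume g e s := by
  rw [chartVolume_apply hs, chartVolume_apply (hs.inter e.open_source.measurableSet)]
  congr 2
  ext w
  simp only [Set.mem_inter_iff, Set.mem_preimage]
  constructor
  · rintro ⟨⟨h1, -⟩, h2⟩; exact ⟨h1, h2⟩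
  · rintro ⟨h1, h2⟩; exact ⟨⟨h1, e.map_target h2⟩, h2⟩

end

variable [IsManifold 𝓘(ℂ, Fin n → ℂ) ω X]

lemma chartDensity_pos (he : e ∈ atlas (Fin n → ℂ) X) (hz : z ∈ e.target) :
    0 < chartDensity g e z :=
  mul_pos (by positivity) (Complex.pos_iff.1 (metric_posDef he hz).det_pos).1

/-- The Jacobian of a holomorphic coordinate change `φ` is `|det ∂φ|²`. -/
lemma abs_det_coordChange (he : e ∈ atlas (Fin n → ℂ) X) (he' : e' ∈ atlas (Fin n → ℂ) X)
    (hz : z ∈ (e.symm.trans e').source) :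
    |(fderiv ℝ (e' ∘ e.symm) z).det| = Complex.normSq (jacobian e e' z).det := by
  rw [(differentiableAt_coordChange he he' hz).fderiv_restrictScalars ℝ]
  have h1 : ((fderiv ℂ (e' ∘ e.symm) z).restrictScalars ℝ).det
      = LinearMap.det ((fderiv ℂ (e' ∘ e.symm) z : (Fin n → ℂ) →ₗ[ℂ] Fin n → ℂ).restrictScalars
          ℝ) := rfl
  have h2 : LinearMap.toMatrix' (fderiv ℂ (e' ∘ e.symm) z : (Fin n → ℂ) →ₗ[ℂ] Fin n → ℂ)
      = (jacobian e e' z)ᵀ := by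
    ext i j
    simp [LinearMap.toMatrix'_apply, jacobian]
  rw [h1, LinearMap.det_restrictScalars, Algebra.norm_complex_apply, ← LinearMap.det_toMatrix', h2,
    Matrix.det_transpose, abs_of_nonneg (Complex.normSq_nonneg _)]

lemma chartDensity_coordChange (he : e ∈ atlas (Fin n → ℂ) X) (he' : e' ∈ atlas (Fin n → ℂ) X)
    (hz : z ∈ (e.symm.trans e').source) :
    chartDensity g e z
      = Complex.normSq (jacobian e e' z).det * chartDensity g e' (e' (e.symm z)) := by
  have h : (metric g e z).det = Complex.normSq (jacobian e e' z).det
      * (metric g e' (e' (e.symm z))).det := by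
    rw [metric_eq_mul he he' hz, Matrix.det_mul, Matrix.det_mul, Matrix.det_conjTranspose,
      Complex.normSq_eq_conj_mul_self, Complex.star_def]
    ring
  rw [chartDensity, h, Complex.re_ofReal_mul, chartDensity]
  ring

variable [MeasurableSpace X] [BorelSpace X]

/-- The volumes of two charts agree on the overlap, by the change of variables formula. -/
lemma chartVolume_eq_of_subset (he : e ∈ atlas (Fin n → ℂ) X) (he' : e' ∈ atlas (Fin n → ℂ) X)
    {s : Set X} (hs : MeasurableSet s) (h : s ⊆ e.source) (h' : s ⊆ e'.source) :
    chartVolume g e s = chartVolume g e' s := by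
  set A := e.symm ⁻¹' s ∩ e.target with hA
  have hAm : MeasurableSet A := measurableSet_symm_preimage_inter e hs
  have hAs : ∀ w ∈ A, w ∈ (e.symm.trans e').source := fun w hw =>
    mem_trans_source_iff.2 ⟨hw.2, h' hw.1⟩
  have himage : (e' ∘ e.symm) '' A = e'.symm ⁻¹' s ∩ e'.target := by
    ext w
    constructor
    · rintro ⟨y, hy, rfl⟩
      refine ⟨?_, e'.map_source (h' hy.1)⟩
      change e'.symm (e' (e.symm y)) ∈ s
      rw [e'.left_inv (h' hy.1)]
      exact hy.1
    · rintro ⟨h1, h2⟩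
      refine ⟨e (e'.symm w), ⟨?_, e.map_source (h h1)⟩, ?_⟩
      · change e.symm (e (e'.symm w)) ∈ s
        rw [e.left_inv (h h1)]
        exact h1
      · rw [Function.comp_apply, e.left_inv (h h1), e'.right_inv h2]
  have hinj : Set.InjOn (e' ∘ e.symm) A := fun y hy w hw hyw =>
    e.symm.injOn hy.2 hw.2 (e'.injOn (h' hy.1) (h' hw.1) hyw)
  have hd : ∀ w ∈ A, HasFDerivWithinAt (e' ∘ e.symm) (fderiv ℝ (e' ∘ e.symm) w) A w :=
    fun w hw => ((differentiableAt_coordChange he he' (hAs w hw)).restrictScalars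
      ℝ).hasFDerivAt.hasFDerivWithinAt
  rw [chartVolume_apply hs, chartVolume_apply hs, ← himage,
    lintegral_image_eq_lintegral_abs_det_fderiv_mul volume hAm hd hinj]
  refine setLIntegral_congr_fun hAm fun w hw => ?_
  rw [abs_det_coordChange he he' (hAs w hw), ← ENNReal.ofReal_mul (Complex.normSq_nonneg _),
    chartDensity_coordChange he he' (hAs w hw)]
  rfl

variable [CompactSpace X]

variable (g) in
/-- On the domain of a chart, `ωⁿ` is given by the chart volume: gluing the chart volumes of a
countable cover along a disjoint partition yields a measure that dominates all chart volumes. -/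
lemma volumeMeasure_apply_of_subset (he : e ∈ atlas (Fin n → ℂ) X) {s : Set X}
    (hs : MeasurableSet s) (hse : s ⊆ e.source) :
    volumeMeasure g s = chartVolume g e s := by
  refine le_antisymm ?_ ?_
  · rcases isEmpty_or_nonempty X with hX | hX
    · simp [Set.eq_empty_of_isEmpty s]
    obtain ⟨t, ht, hcov⟩ := countable_cover_nhds
      (fun x : X => (chartAt (Fin n → ℂ) x).open_source.mem_nhds (mem_chart_source _ x))
    have htne : t.Nonempty := by
      by_contra h0
      refine Set.empty_ne_univ (α := X) ?_
      simpa [Set.not_nonempty_iff_eq_empty.1 h0] using hcov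
    obtain ⟨c, rfl⟩ := ht.exists_eq_range htne
    set C : ℕ → OpenPartialHomeomorph X (Fin n → ℂ) := fun i => chartAt (Fin n → ℂ) (c i)
    have hC : ∀ i, C i ∈ atlas (Fin n → ℂ) X := fun i => chart_mem_atlas _ _
    set D : ℕ → Set X := disjointed fun i => (C i).source
    have hDm : ∀ i, MeasurableSet (D i) := fun i =>
      MeasurableSet.disjointed (fun j => (C j).open_source.measurableSet) i
    have hDs : ∀ i, D i ⊆ (C i).source := fun i => disjointed_subset _ i
    have hDu : ⋃ i, D i = Set.univ := by
      rw [iUnion_disjointed, ← hcov, Set.biUnion_range]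
    -- `μ₀` is the measure glued from the chart volumes; `key` says that it restricts to each of
    -- them, so it dominates their supremum.
    set μ₀ : Measure X := Measure.sum fun i => (chartVolume g (C i)).restrict (D i) with hμ₀
    have key : ∀ e ∈ atlas (Fin n → ℂ) X, ∀ s, MeasurableSet s → s ⊆ e.source →
        μ₀ s = chartVolume g e s := by
      intro e he s hs hse
      rw [hμ₀, Measure.sum_apply _ hs]
      have h1 : ∀ i, (chartVolume g (C i)).restrict (D i) s = chartVolume g e (s ∩ D i) := by
        intro i
        rw [Measure.restrict_apply hs]
        exact chartVolume_eq_of_subset (hC i) he (hs.inter (hDm i))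
          (Set.inter_subset_right.trans (hDs i)) (Set.inter_subset_left.trans hse)
      simp only [h1]
      rw [← measure_iUnion _ fun i => hs.inter (hDm i), ← Set.inter_iUnion, hDu, Set.inter_univ]
      exact fun i j hij => ((disjoint_disjointed _ hij).mono Set.inter_subset_right
        Set.inter_subset_right)
    rw [← key e he s hs hse]
    refine Measure.le_iff'.1 (iSup₂_le fun e' he'' => Measure.le_iff.2 fun s' hs' => ?_) s
    rw [← chartVolume_inter_source hs', ← key e' he'' _ (hs'.inter e'.open_source.measurableSet)
      Set.inter_subset_right]
    exact measure_mono Set.inter_subset_left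
  · exact Measure.le_iff'.1 (le_iSup₂ (f := fun e (_ : e ∈ atlas (Fin n → ℂ) X) =>
      chartVolume g e) e he) s

lemma restrict_volumeMeasure (he : e ∈ atlas (Fin n → ℂ) X) :
    (volumeMeasure g).restrict e.source = chartVolume g e := by
  ext s hs
  rw [Measure.restrict_apply hs, volumeMeasure_apply_of_subset g he
    (hs.inter e.open_source.measurableSet) Set.inter_subset_right, chartVolume_inter_source hs]

instance isFiniteMeasure_volumeMeasure : IsFiniteMeasure (volumeMeasure g) := by
  refine ⟨isCompact_univ.measure_lt_top_of_nhdsWithin fun x _ => ?_⟩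
  set e := chartAt (Fin n → ℂ) x
  have he : e ∈ atlas (Fin n → ℂ) X := chart_mem_atlas _ x
  have hx : x ∈ e.source := mem_chart_source _ x
  obtain ⟨K, hK, hxK, hKe⟩ := exists_compact_subset e.open_target (e.map_source hx)
  rw [nhdsWithin_univ]
  have hU := e.isOpen_inter_preimage isOpen_interior (s := interior K)
  refine ⟨e.source ∩ e ⁻¹' interior K, hU.mem_nhds ⟨hx, hxK⟩, ?_⟩
  rw [volumeMeasure_apply_of_subset g he hU.measurableSet Set.inter_subset_left,
    chartVolume_apply hU.measurableSet]
  have hsub : e.symm ⁻¹' (e.source ∩ e ⁻¹' interior K) ∩ e.target ⊆ K := by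
    rintro w ⟨⟨-, h2⟩, h3⟩
    have h4 : e (e.symm w) ∈ interior K := h2
    rw [e.right_inv h3] at h4
    exact interior_subset h4
  refine (lintegral_mono_set hsub).trans_lt ?_
  have hint := ((continuousOn_chartDensity (g := g) he).mono hKe).integrableOn_compact
    (μ := volume) hK
  exact hint.lintegral_lt_top

lemma integral_volumeMeasure_of_support_subset (he : e ∈ atlas (Fin n → ℂ) X) {F : X → ℝ}
    (hF : Continuous F) (hsupp : Function.support F ⊆ e.source) :
    ∫ x, F x ∂(volumeMeasure g)
      = ∫ w in e.target, chartDensity g e w * F (e.symm w) := by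
  rw [← setIntegral_eq_integral_of_forall_compl_eq_zero (s := e.source) fun x hx => by
    by_contra h; exact hx (hsupp h), restrict_volumeMeasure he, chartVolume,
    integral_map ((aemeasurable_symm e).mono_ac (withDensity_absolutelyContinuous _ _))
      hF.aestronglyMeasurable]
  have hm : AEMeasurable (fun w => ENNReal.ofReal (chartDensity g e w))
      (volume.restrict e.target) :=
    ((continuousOn_chartDensity he).aemeasurable e.open_target.measurableSet).ennreal_ofReal
  refine (integral_withDensity_eq_integral_toReal_smul₀ hm (by simp) _).trans ?_
  refine setIntegral_congr_fun e.open_target.measurableSet fun w hw => ?_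
  rw [ENNReal.toReal_ofReal (chartDensity_pos he hw).le, smul_eq_mul]

end Volume

/-! ### The divergence theorem in a chart -/

section Divergence

open Filter Topology
open scoped ComplexOrder

variable {n : ℕ}

lemma dz_finsetProd {ι : Type*} [DecidableEq ι] (s : Finset ι) {F : ι → (Fin n → ℂ) → ℂ}
    {z : Fin n → ℂ} {l : Fin n} (hF : ∀ a ∈ s, DifferentiableAt ℝ (F a) z) :
    dz l (fun w => ∏ a ∈ s, F a w) z = ∑ a ∈ s, (∏ b ∈ s.erase a, F b z) * dz l (F a) z := by
  simp only [dz, fderiv_finsetProd hF, sum_apply, smul_apply, smul_eq_mul, Finset.mul_sum,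
    ← Finset.sum_sub_distrib, Finset.sum_div]
  exact Finset.sum_congr rfl fun a _ => by ring

/-- **Jacobi's formula** for the derivative of a determinant. -/
lemma dz_det {A : (Fin n → ℂ) → Matrix (Fin n) (Fin n) ℂ} {z : Fin n → ℂ} (l : Fin n)
    (hA : ∀ i j, DifferentiableAt ℝ (fun w => A w i j) z) :
    dz l (fun w => (A w).det) z = ((A z).adjugate * dzMat l A z).trace := by
  have hd : ∀ σ : Equiv.Perm (Fin n), DifferentiableAt ℝ (fun w => ∏ i, A w (σ i) i) z :=
    fun σ => (HasFDerivAt.finsetProd fun i _ => (hA (σ i) i).hasFDerivAt).differentiableAt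
  have h1 : ∀ i, ((A z).adjugate * dzMat l A z) i i
      = ((A z).updateCol i fun k => dzMat l A z k i).det := by
    intro i
    rw [← Matrix.cramer_apply, Matrix.cramer_eq_adjugate_mulVec]
    rfl
  simp only [Matrix.trace, Matrix.diag, h1, Matrix.det_apply']
  rw [dz_sum _ fun σ _ => (differentiableAt_const _).fun_mul (hd σ), Finset.sum_comm]
  refine Finset.sum_congr rfl fun σ _ => ?_
  rw [dz_mul (differentiableAt_const _) (hd σ), dz_const, zero_mul, zero_add,
    dz_finsetProd _ fun i _ => hA _ _, Finset.mul_sum]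
  refine Finset.sum_congr rfl fun i _ => ?_
  rw [← Finset.mul_prod_erase Finset.univ _ (Finset.mem_univ i), Matrix.updateCol_self]
  have h2 : ∏ b ∈ Finset.univ.erase i, (A z).updateCol i (fun k => dzMat l A z k i) (σ b) b
      = ∏ b ∈ Finset.univ.erase i, A z (σ b) b :=
    Finset.prod_congr rfl fun b hb => Matrix.updateCol_ne (Finset.ne_of_mem_erase hb)
  rw [h2, dzMat, Matrix.of_apply]
  ring

lemma integral_dz_eq_zero {f : (Fin n → ℂ) → ℂ} (hf : ContDiff ℝ ∞ f)
    (hc : HasCompactSupport f) (j : Fin n) : ∫ z, dz j f z = 0 := by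
  have h1 : ∀ v, Integrable (fun z => fderiv ℝ f z v) := fun v =>
    ((hf.continuous_fderiv (by simp)).clm_apply continuous_const).integrable_of_hasCompactSupport
      (hc.fderiv_apply ℝ v)
  have h2 : ∀ v, ∫ z, fderiv ℝ f z v = 0 := by
    intro v
    have h := integral_mul_fderiv_eq_neg_fderiv_mul_of_integrable (𝕜 := ℂ) (μ := volume)
      (f := fun _ : Fin n → ℂ => (1 : ℂ)) (g := f) (v := v) (by simp) (by simpa using h1 v)
      (by simpa using hf.continuous.integrable_of_hasCompactSupport hc)
      (fun x _ => differentiableAt_const _) (fun x _ => (hf.differentiable (by simp)) x)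
    simpa using h
  simp only [dz]
  rw [integral_div, integral_sub (h1 _) ((h1 _).const_mul _), integral_const_mul, h2, h2]
  simp

lemma integrable_dz {f : (Fin n → ℂ) → ℂ} (hf : ContDiff ℝ ∞ f)
    (hc : HasCompactSupport f) (j : Fin n) : Integrable (dz j f) := by
  have h1 : ∀ v, Integrable (fun z => fderiv ℝ f z v) := fun v =>
    ((hf.continuous_fderiv (by simp)).clm_apply continuous_const).integrable_of_hasCompactSupport
      (hc.fderiv_apply ℝ v)
  exact ((h1 _).sub ((h1 _).const_mul _)).div_const _

variable {X : Type*} [TopologicalSpace X] [ChartedSpace (Fin n → ℂ) X]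
  [IsManifold 𝓘(ℂ, Fin n → ℂ) ω X]
  {g : KahlerMetric n X} {e : OpenPartialHomeomorph X (Fin n → ℂ)} {z : Fin n → ℂ}
  {u v : X → ℝ}

lemma dz_metric_det (he : e ∈ atlas (Fin n → ℂ) X) (hz : z ∈ e.target) (l : Fin n) :
    dz l (fun w => (metric g e w).det) z
      = (metric g e z).det * ((metric g e z)⁻¹ * dzMat l (metric g e) z).trace := by
  rw [dz_det l (differentiableAt_metric he hz), Matrix.inv_def, Matrix.smul_mul,
    Matrix.trace_smul, smul_eq_mul, ← mul_assoc,
    Ring.mul_inverse_cancel _ (metric_isUnit_det he hz), one_mul]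

/-- The divergence of the vector field `v ∇u`, multiplied by the density `det g`. -/
lemma sum_dz_mul_gradUp (hu : ContDiffOn ℝ ∞ (inChart u e) e.target)
    (hv : ContDiffOn ℝ ∞ (inChart v e) e.target) (he : e ∈ atlas (Fin n → ℂ) X)
    (hz : z ∈ e.target) :
    ∑ j, dz j (fun w => (metric g e w).det * (inChart v e w * gradUp g u e j w)) z
      = (metric g e z).det
        * (inChart v e z * chartLaplacian g e u z + chartPairing g e v u z) := by
  have hy := fun j => differentiableAt_of_contDiffOn e.open_target
    (contDiffOn_gradUp (g := g) hu he j) hz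
  have hv' := differentiableAt_of_contDiffOn e.open_target hv hz
  have hdet := differentiableAt_of_contDiffOn e.open_target
    (contDiffOn_metric_det (g := g) he) hz
  have hdiv : ∑ j, dz j (gradUp g u e j) z = chartLaplacian g e u z
      - ∑ j, gradUp g u e j z * ((metric g e z)⁻¹ * dzMat j (metric g e) z).trace := by
    have h := congrArg Matrix.trace (dz_gradUp (g := g) hu he hz)
    rw [Matrix.sub_mul, Matrix.sum_mul, Matrix.trace_sub, Matrix.trace_sum,
      Matrix.trace_mul_comm, ← chartLaplacian_eq_trace] at h
    simp only [Matrix.smul_mul, Matrix.trace_smul, smul_eq_mul] at h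
    simp only [Matrix.trace_mul_comm (metric g e z)⁻¹]
    exact h
  have h1 : ∀ j, dz j (fun w => (metric g e w).det * (inChart v e w * gradUp g u e j w)) z
      = (metric g e z).det * (inChart v e z * (gradUp g u e j z
          * ((metric g e z)⁻¹ * dzMat j (metric g e) z).trace)
        + gradUp g u e j z * dz j (inChart v e) z + inChart v e z * dz j (gradUp g u e j) z) := by
    intro j
    rw [dz_mul hdet (hv'.fun_mul (hy j)), dz_mul hv' (hy j), dz_metric_det he hz]
    ring
  simp only [h1]
  rw [← Finset.mul_sum, Finset.sum_add_distrib, Finset.sum_add_distrib, ← Finset.mul_sum,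
    ← Finset.mul_sum, hdiv, chartPairing_eq_sum_gradUp]
  ring

variable [CompactSpace X]

omit [ChartedSpace (Fin n → ℂ) X] [IsManifold 𝓘(ℂ, Fin n → ℂ) ω X] in
/-- A smooth function on the target of a chart that vanishes outside the image of the closed
support of `v` extends by zero to a smooth compactly supported function on `ℂⁿ`. -/
lemma contDiff_indicator_of_tsupport_subset {f : (Fin n → ℂ) → ℂ}
    (hf : ContDiffOn ℝ ∞ f e.target) (hv : tsupport v ⊆ e.source)
    (hfv : ∀ w ∈ e.target, v (e.symm w) = 0 → f w = 0) :
    ContDiff ℝ ∞ (e.target.indicator f) ∧ HasCompactSupport (e.target.indicator f) ∧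
      tsupport (e.target.indicator f) ⊆ e.target := by
  have hK : IsCompact (e '' tsupport v) :=
    (isClosed_tsupport v).isCompact.image_of_continuousOn (e.continuousOn.mono hv)
  have h0 : ∀ w, w ∉ e '' tsupport v → e.target.indicator f w = 0 := by
    intro w hw
    by_cases hwt : w ∈ e.target
    · rw [Set.indicator_of_mem hwt]
      refine hfv w hwt ?_
      by_contra hne
      exact hw ⟨e.symm w, subset_tsupport v hne, e.right_inv hwt⟩
    · exact Set.indicator_of_notMem hwt f
  have hKe : e '' tsupport v ⊆ e.target := by
    rintro _ ⟨x, hx, rfl⟩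
    exact e.map_source (hv hx)
  refine ⟨contDiff_iff_contDiffAt.2 fun w => ?_, .intro hK fun w hw => h0 w hw,
    (closure_minimal (Function.support_subset_iff'.2 h0) hK.isClosed).trans hKe⟩
  by_cases hw : w ∈ e.target
  · refine (hf.contDiffAt (e.open_target.mem_nhds hw)).congr_of_eventuallyEq ?_
    filter_upwards [e.open_target.mem_nhds hw] with y hy
    exact Set.indicator_of_mem hy f
  · have hw' : w ∈ (e '' tsupport v)ᶜ := fun h => hw (hKe h)
    refine (contDiffAt_const (c := (0 : ℂ))).congr_of_eventuallyEq ?_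
    filter_upwards [hK.isClosed.isOpen_compl.mem_nhds hw'] with y hy
    exact h0 y hy

/-- Green's formula `∫ (v Δu + ⟨∂v, ∂u⟩) ωⁿ = 0` for `v` supported in the domain of a chart. -/
lemma setIntegral_chartDensity_mul_eq_zero (hu : ContDiffOn ℝ ∞ (inChart u e) e.target)
    (hv : ContDiffOn ℝ ∞ (inChart v e) e.target) (he : e ∈ atlas (Fin n → ℂ) X)
    (hsupp : tsupport v ⊆ e.source) :
    ∫ w in e.target, chartDensity g e w
      * (inChart v e w * chartLaplacian g e u w + chartPairing g e v u w).re = 0 := by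
  set Ψ : Fin n → (Fin n → ℂ) → ℂ := fun j =>
    e.target.indicator fun w => (metric g e w).det * (inChart v e w * gradUp g u e j w) with hΨ
  have hΨ' : ∀ j, ContDiff ℝ ∞ (Ψ j) ∧ HasCompactSupport (Ψ j) ∧ tsupport (Ψ j) ⊆ e.target :=
    fun j =>
    contDiff_indicator_of_tsupport_subset
      ((contDiffOn_metric_det he).mul (hv.mul (contDiffOn_gradUp hu he j))) hsupp
      fun w _ hw => by simp [inChart, hw]
  have h0 : ∫ w, ∑ j, dz j (Ψ j) w = 0 := by
    rw [integral_finsetSum _ fun j _ => integrable_dz (hΨ' j).1 (hΨ' j).2.1 j]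
    exact Finset.sum_eq_zero fun j _ => integral_dz_eq_zero (hΨ' j).1 (hΨ' j).2.1 j
  have hint : Integrable fun w => ∑ j, dz j (Ψ j) w :=
    integrable_finsetSum _ fun j _ => integrable_dz (hΨ' j).1 (hΨ' j).2.1 j
  have h1 : ∀ w ∈ e.target, chartDensity g e w
      * (inChart v e w * chartLaplacian g e u w + chartPairing g e v u w).re
      = 2 ^ n * (n.factorial : ℝ) * (∑ j, dz j (Ψ j) w).re := by
    intro w hw
    have h2 : ∀ j, dz j (Ψ j) w
        = dz j (fun w => (metric g e w).det * (inChart v e w * gradUp g u e j w)) w := by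
      intro j
      refine dz_congr ?_
      filter_upwards [e.open_target.mem_nhds hw] with y hy
      exact Set.indicator_of_mem hy _
    have him : (metric g e w).det = ((metric g e w).det.re : ℂ) :=
      Complex.ext (by simp) (by simpa using
        (Complex.pos_iff.1 (metric_posDef (g := g) he hw).det_pos).2.symm)
    simp only [h2]
    rw [sum_dz_mul_gradUp hu hv he hw, him, Complex.re_ofReal_mul, chartDensity]
    ring
  rw [setIntegral_congr_fun e.open_target.measurableSet h1, integral_const_mul]
  have h3 : ∀ w, w ∉ e.target → (∑ j, dz j (Ψ j) w).re = 0 := by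
    intro w hw
    have h4 : ∀ j, dz j (Ψ j) w = 0 := by
      intro j
      have hw' : w ∉ tsupport (Ψ j) := fun h => hw ((hΨ' j).2.2 h)
      rw [dz_congr (g := fun _ => (0 : ℂ)) (notMem_tsupport_iff_eventuallyEq.1 hw'), dz_const]
    simp [h4]
  rw [setIntegral_eq_integral_of_forall_compl_eq_zero h3]
  have h5 := congrArg Complex.re h0
  rw [← Complex.reCLM_apply, ← ContinuousLinearMap.integral_comp_comm _ hint] at h5
  rw [show ∫ w, (∑ j, dz j (Ψ j) w).re = 0 from h5, mul_zero]

end Divergence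

/-! ### Smooth functions and Green's formula on a compact manifold -/

section Green

open Filter Topology ComplexConjugate

variable {n : ℕ} {X : Type*} [TopologicalSpace X] [ChartedSpace (Fin n → ℂ) X]
  {g : KahlerMetric n X} {e : OpenPartialHomeomorph X (Fin n → ℂ)} {x : X} {u v : X → ℝ}

variable (n) in
/-- A real function on `X` is smooth if it is so in the charts of the atlas. -/
def IsSmooth (u : X → ℝ) : Prop :=
  ∀ e ∈ atlas (Fin n → ℂ) X, ContDiffOn ℝ ∞ (inChart u e) e.target

omit [ChartedSpace (Fin n → ℂ) X] in
lemma inChart_apply_self (u : X → ℝ) (hx : x ∈ e.source) : inChart u e (e x) = u x := by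
  rw [inChart, e.left_inv hx]

/-- A complex function on `X` that agrees with a continuous function of the coordinates in each
chart is continuous. -/
lemma continuous_of_forall_chart {f : X → ℂ}
    {fc : OpenPartialHomeomorph X (Fin n → ℂ) → (Fin n → ℂ) → ℂ}
    (hfc : ∀ e ∈ atlas (Fin n → ℂ) X, ContinuousOn (fc e) e.target)
    (h : ∀ e ∈ atlas (Fin n → ℂ) X, ∀ x ∈ e.source, f x = fc e (e x)) : Continuous f := by
  refine continuous_iff_continuousAt.2 fun x => ?_
  set e := chartAt (Fin n → ℂ) x
  have he : e ∈ atlas (Fin n → ℂ) X := chart_mem_atlas _ x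
  have hx : x ∈ e.source := mem_chart_source _ x
  have h1 : ContinuousAt (fun y => fc e (e y)) x :=
    ((hfc e he).continuousAt (e.open_target.mem_nhds (e.map_source hx))).comp
      (e.continuousAt hx)
  refine h1.congr ?_
  filter_upwards [e.open_source.mem_nhds hx] with y hy
  exact (h e he y hy).symm

lemma IsSmooth.continuous (hu : IsSmooth n u) : Continuous u := by
  have h : Continuous fun x => (u x : ℂ) :=
    continuous_of_forall_chart (fc := fun e => inChart u e) (fun e he => (hu e he).continuousOn)
      fun e _ x hx => (inChart_apply_self u hx).symm
  exact Complex.continuous_re.comp h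

lemma IsSmooth.mul (hu : IsSmooth n u) (hv : IsSmooth n v) :
    IsSmooth n fun x => u x * v x := fun e he => by
  refine ((hu e he).mul (hv e he)).congr fun w _ => ?_
  simp [inChart]

lemma isSmooth_of_forall_chart {fc : OpenPartialHomeomorph X (Fin n → ℂ) → (Fin n → ℂ) → ℂ}
    (hfc : ∀ e ∈ atlas (Fin n → ℂ) X, ContDiffOn ℝ ∞ (fc e) e.target)
    (h : ∀ e ∈ atlas (Fin n → ℂ) X, ∀ x ∈ e.source, u x = (fc e (e x)).re) :
    IsSmooth n u := fun e he => by
  have h1 : ContDiffOn ℝ ∞ (fun w => ((fc e w).re : ℂ)) e.target :=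
    (Complex.ofRealCLM.comp Complex.reCLM).contDiff.comp_contDiffOn (hfc e he)
  refine h1.congr fun w hw => ?_
  rw [inChart, h e he _ (e.map_target hw), e.right_inv hw]

/-- The real part of `⟨∂u, ∂v⟩`, as a function on `X`. -/
noncomputable def pairing (g : KahlerMetric n X) (u v : X → ℝ) (x : X) : ℝ :=
  (chartPairing g (chartAt (Fin n → ℂ) x) u v (chartAt (Fin n → ℂ) x x)).re

lemma mem_source_of_mem (hx : x ∈ e.source) :
    chartAt (Fin n → ℂ) x x ∈ ((chartAt (Fin n → ℂ) x).symm.trans e).source := by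
  rw [mem_trans_source_iff]
  refine ⟨mem_chart_target _ x, ?_⟩
  rwa [(chartAt (Fin n → ℂ) x).left_inv (mem_chart_source _ x)]

lemma pairing_sum {ι : Type*} (s : Finset ι) {F : ι → X → ℝ} (hF : ∀ i ∈ s, IsSmooth n (F i))
    (v : X → ℝ) (x : X) :
    pairing g (fun y => ∑ i ∈ s, F i y) v x = ∑ i ∈ s, pairing g (F i) v x := by
  set e := chartAt (Fin n → ℂ) x
  have he : e ∈ atlas (Fin n → ℂ) X := chart_mem_atlas _ x
  have h1 : inChart (fun y => ∑ i ∈ s, F i y) e = fun w => ∑ i ∈ s, inChart (F i) e w := by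
    ext w
    simp [inChart]
  have h2 : ∀ j, dz j (inChart (fun y => ∑ i ∈ s, F i y) e) (e x)
      = ∑ i ∈ s, dz j (inChart (F i) e) (e x) := fun j => by
    rw [h1, dz_sum _ fun i hi => differentiableAt_of_contDiffOn e.open_target (hF i hi e he)
      (mem_chart_target _ x)]
  change (chartPairing g e _ v (e x)).re = ∑ i ∈ s, (chartPairing g e (F i) v (e x)).re
  rw [← Complex.re_sum]
  simp only [chartPairing_eq_sum_gradUp, h2, Finset.mul_sum]
  rw [Finset.sum_comm]

variable [IsManifold 𝓘(ℂ, Fin n → ℂ) ω X]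

variable (n X) in
lemma isManifold_real : IsManifold 𝓘(ℝ, Fin n → ℂ) ∞ X := by
  refine isManifold_of_contDiffOn _ _ _ fun e e' he he' => ?_
  have h := ((contDiffOn_coordChange he he').restrict_scalars ℝ).of_le
    (le_top : (∞ : WithTop ℕ∞) ≤ ω)
  simpa [Function.comp_def] using h

lemma isSmooth_of_contMDiff (hu : ContMDiff 𝓘(ℝ, Fin n → ℂ) 𝓘(ℝ, ℝ) ∞ u) : IsSmooth n u :=
  fun e he => by
  have := isManifold_real n X
  have h1 := contMDiffOn_symm_of_mem_maximalAtlas (I := 𝓘(ℝ, Fin n → ℂ)) (n := ∞)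
    (IsManifold.subset_maximalAtlas he)
  have h2 := (hu.comp_contMDiffOn h1).contDiffOn
  exact Complex.ofRealCLM.contDiff.comp_contDiffOn h2

lemma pairing_eq (hu : IsSmooth n u) (hv : IsSmooth n v) (he : e ∈ atlas (Fin n → ℂ) X)
    (hx : x ∈ e.source) : pairing g u v x = (chartPairing g e u v (e x)).re := by
  rw [pairing, chartPairing_coordChange (chart_mem_atlas _ x) he (mem_source_of_mem hx) (hu e he)
    (hv e he), (chartAt (Fin n → ℂ) x).left_inv (mem_chart_source _ x)]

lemma laplacian_eq (hu : IsSmooth n u) (he : e ∈ atlas (Fin n → ℂ) X)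
    (hx : x ∈ e.source) : laplacian g u x = (chartLaplacian g e u (e x)).re := by
  change (chartLaplacian g (chartAt (Fin n → ℂ) x) u (chartAt (Fin n → ℂ) x x)).re = _
  rw [chartLaplacian_coordChange (chart_mem_atlas _ x) he (mem_source_of_mem hx) (hu e he),
    (chartAt (Fin n → ℂ) x).left_inv (mem_chart_source _ x)]

lemma hessGradGrad_eq (hu : IsSmooth n u) (he : e ∈ atlas (Fin n → ℂ) X)
    (hx : x ∈ e.source) : hessGradGrad g u x = chartHessGradGrad g e u (e x) := by
  change chartHessGradGrad g (chartAt (Fin n → ℂ) x) u (chartAt (Fin n → ℂ) x x) = _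
  rw [chartHessGradGrad_coordChange (chart_mem_atlas _ x) he (mem_source_of_mem hx) (hu e he),
    (chartAt (Fin n → ℂ) x).left_inv (mem_chart_source _ x)]

lemma IsSmooth.pairing (hu : IsSmooth n u) (hv : IsSmooth n v) : IsSmooth n (pairing g u v) :=
  isSmooth_of_forall_chart (fun e he => contDiffOn_chartPairing (hu e he) he (hv e he))
    fun _ he _ hx => pairing_eq hu hv he hx

lemma IsSmooth.laplacian (hu : IsSmooth n u) : IsSmooth n (laplacian g u) :=
  isSmooth_of_forall_chart (fun e he => contDiffOn_chartLaplacian (hu e he) he)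
    fun _ he _ hx => laplacian_eq hu he hx

lemma continuous_hessGradGrad (hu : IsSmooth n u) : Continuous (hessGradGrad g u) :=
  continuous_of_forall_chart (fc := fun e => chartHessGradGrad g e u)
    (fun e he => (ContDiffOn.sum fun j _ => ContDiffOn.sum fun k _ =>
      ((contDiffOn_hess (hu e he) j k).mul (contDiffOn_gradUp (hu e he) he j)).mul
        (contDiffOn_gradUpBar (hu e he) he k)).continuousOn)
    fun _ he _ hx => hessGradGrad_eq hu he hx

variable [CompactSpace X] [MeasurableSpace X] [BorelSpace X]

lemma IsSmooth.integrable (hu : IsSmooth n u) : Integrable u (volumeMeasure g) :=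
  hu.continuous.integrable_of_hasCompactSupport (.of_compactSpace _)

lemma integral_green_of_tsupport_subset (hu : IsSmooth n u) (hv : IsSmooth n v)
    (he : e ∈ atlas (Fin n → ℂ) X) (hsupp : tsupport v ⊆ e.source) :
    ∫ x, (v x * laplacian g u x + pairing g v u x) ∂(volumeMeasure g) = 0 := by
  have h0 : ∀ x, x ∉ e.source → v x * laplacian g u x + pairing g v u x = 0 := by
    intro x hx
    have hx' : x ∉ tsupport v := fun h => hx (hsupp h)
    have hvx : v x = 0 := image_eq_zero_of_notMem_tsupport hx'
    set c := chartAt (Fin n → ℂ) x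
    have hcx : x ∈ c.source := mem_chart_source _ x
    have h1 : inChart v c =ᶠ[𝓝 (c x)] fun _ => (0 : ℂ) := by
      have h2 : ∀ᶠ y in 𝓝 (c.symm (c x)), v y = 0 := by
        rw [c.left_inv hcx]
        exact notMem_tsupport_iff_eventuallyEq.1 hx'
      filter_upwards [(c.continuousAt_symm (c.map_source hcx)).eventually h2] with w hw
      simp [inChart, hw]
    have h3 : chartPairing g c v u (c x) = 0 := by
      simp [chartPairing, dz_congr h1, dz_const]
    change _ + (chartPairing g c v u (c x)).re = 0
    rw [h3, hvx]
    simp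
  have hcont : Continuous fun x => v x * laplacian g u x + pairing g v u x :=
    (hv.continuous.mul hu.laplacian.continuous).add (hv.pairing hu).continuous
  rw [integral_volumeMeasure_of_support_subset he hcont
    (Function.support_subset_iff'.2 h0), ← setIntegral_chartDensity_mul_eq_zero
    (g := g) (hu e he) (hv e he) he hsupp]
  refine setIntegral_congr_fun e.open_target.measurableSet fun w hw => ?_
  have hw' := e.map_target hw
  rw [laplacian_eq hu he hw', pairing_eq hv hu he hw', e.right_inv hw, Complex.add_re, inChart,
    Complex.re_ofReal_mul]

/-- **Green's formula** `∫ (v Δu + Re ⟨∂v, ∂u⟩) ωⁿ = 0`. -/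
theorem integral_green [T2Space X] (hu : IsSmooth n u) (hv : IsSmooth n v) :
    ∫ x, (v x * laplacian g u x + pairing g v u x) ∂(volumeMeasure g) = 0 := by
  have := isManifold_real n X
  obtain ⟨t, ht⟩ := isCompact_univ.elim_finite_subcover
    (fun x : X => (chartAt (Fin n → ℂ) x).source) (fun x => (chartAt _ x).open_source)
    fun x _ => Set.mem_iUnion.2 ⟨x, mem_chart_source _ x⟩
  obtain ⟨ρ, hρ⟩ := SmoothPartitionOfUnity.exists_isSubordinate 𝓘(ℝ, Fin n → ℂ)
    (isClosed_univ (X := X)) (fun i : t => (chartAt (Fin n → ℂ) (i : X)).source)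
    (fun i => (chartAt _ _).open_source) (by simpa [Set.iUnion_subtype] using ht)
  have hρs : ∀ i, IsSmooth n (ρ i) := fun i => isSmooth_of_contMDiff (ρ i).contMDiff
  have hsum : ∀ x, ∑ i, ρ i x = 1 := fun x => by
    rw [← finsum_eq_sum_of_fintype]
    exact ρ.sum_eq_one (Set.mem_univ x)
  have hv' : v = fun x => ∑ i, ρ i x * v x := by
    ext x
    rw [← Finset.sum_mul, hsum, one_mul]
  have hi : ∀ i, IsSmooth n fun x => ρ i x * v x := fun i => (hρs i).mul hv
  have h1 : ∀ x, v x * laplacian g u x + pairing g v u x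
      = ∑ i, ((ρ i x * v x) * laplacian g u x + pairing g (fun y => ρ i y * v y) u x) := by
    intro x
    conv_lhs => rw [hv']
    rw [pairing_sum _ fun i _ => hi i, Finset.sum_mul, Finset.sum_add_distrib]
  simp only [h1]
  rw [integral_finsetSum]
  · refine Finset.sum_eq_zero fun i _ => ?_
    exact integral_green_of_tsupport_subset hu (hi i) (chart_mem_atlas _ (i : X))
      ((tsupport_mul_subset_left).trans (hρ i))
  · exact fun i _ => ((hi i).mul hu.laplacian).integrable.add ((hi i).pairing hu).integrable

end Green

/-! ### The Bochner inequality on the manifold and the pointwise estimate -/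

section Estimate

open Filter Topology ComplexConjugate
open scoped ComplexOrder

variable {n : ℕ} {X : Type*} [TopologicalSpace X] [ChartedSpace (Fin n → ℂ) X]
  {g : KahlerMetric n X} {e : OpenPartialHomeomorph X (Fin n → ℂ)} {x : X} {z : Fin n → ℂ}
  {u v w : X → ℝ}

lemma chartPairing_eq_star (hv : ContDiffOn ℝ ∞ (inChart v e) e.target) (hz : z ∈ e.target) :
    chartPairing g e u v z = star (fun j => dz j (inChart v e) z) ⬝ᵥ
      (metric g e z)⁻¹ *ᵥ fun j => dz j (inChart u e) z := by
  rw [chartPairing_eq_dotProduct]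
  congr 1
  ext j
  exact (conj_dz hv hz j).symm

lemma pairing_mul (hu : IsSmooth n u) (hv : IsSmooth n v) (w : X → ℝ) (x : X) :
    pairing g (fun y => u y * v y) w x
      = u x * pairing g v w x + v x * pairing g u w x := by
  set e := chartAt (Fin n → ℂ) x
  have he : e ∈ atlas (Fin n → ℂ) X := chart_mem_atlas _ x
  have hx : x ∈ e.source := mem_chart_source _ x
  have h1 : inChart (fun y => u y * v y) e = fun w => inChart u e w * inChart v e w := by
    ext w
    simp [inChart]
  have h2 : ∀ j, dz j (inChart (fun y => u y * v y) e) (e x)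
      = u x * dz j (inChart v e) (e x) + v x * dz j (inChart u e) (e x) := fun j => by
    rw [h1, dz_mul (differentiableAt_of_contDiffOn e.open_target (hu e he) (e.map_source hx))
      (differentiableAt_of_contDiffOn e.open_target (hv e he) (e.map_source hx)),
      inChart_apply_self u hx, inChart_apply_self v hx]
    ring
  change (chartPairing g e _ w (e x)).re
    = u x * (chartPairing g e v w (e x)).re + v x * (chartPairing g e u w (e x)).re
  rw [← Complex.re_ofReal_mul, ← Complex.re_ofReal_mul, ← Complex.add_re]
  congr 1
  simp only [chartPairing_eq_sum_gradUp, h2, Finset.mul_sum, ← Finset.sum_add_distrib]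
  exact Finset.sum_congr rfl fun j _ => by ring

variable [IsManifold 𝓘(ℂ, Fin n → ℂ) ω X]

lemma conj_chartPairing (hu : ContDiffOn ℝ ∞ (inChart u e) e.target)
    (hv : ContDiffOn ℝ ∞ (inChart v e) e.target) (he : e ∈ atlas (Fin n → ℂ) X)
    (hz : z ∈ e.target) : conj (chartPairing g e u v z) = chartPairing g e v u z := by
  rw [chartPairing_eq_sum_gradUpBar, chartPairing_eq_sum_gradUp]
  simp only [map_sum, map_mul, conj_gradUpBar hu he hz, conj_dzbar hv hz]
  exact Finset.sum_congr rfl fun j _ => mul_comm _ _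

lemma conj_chartLaplacian (hu : ContDiffOn ℝ ∞ (inChart u e) e.target)
    (he : e ∈ atlas (Fin n → ℂ) X) (hz : z ∈ e.target) :
    conj (chartLaplacian g e u z) = chartLaplacian g e u z := by
  have hP := (metric_posDef (g := g) he hz).inv.isHermitian
  rw [chartLaplacian_eq_trace, ← Complex.star_def, ← Matrix.trace_conjTranspose,
    Matrix.conjTranspose_mul, hP.eq, (hessMat_isHermitian hu hz).eq, Matrix.trace_mul_comm]

lemma inChart_laplacian (hu : IsSmooth n u) (he : e ∈ atlas (Fin n → ℂ) X) (hz : z ∈ e.target) :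
    inChart (laplacian g u) e z = chartLaplacian g e u z := by
  rw [inChart, laplacian_eq hu he (e.map_target hz), e.right_inv hz]
  exact Complex.conj_eq_iff_re.1 (conj_chartLaplacian (hu e he) he hz)

lemma gradSq_eq (hu : IsSmooth n u) (he : e ∈ atlas (Fin n → ℂ) X) (hx : x ∈ e.source) :
    gradSq g u x = (chartPairing g e u u (e x)).re :=
  pairing_eq hu hu he hx

lemma IsSmooth.gradSq (hu : IsSmooth n u) : IsSmooth n (gradSq g u) :=
  hu.pairing hu

lemma inChart_gradSq (hu : IsSmooth n u) (he : e ∈ atlas (Fin n → ℂ) X) (hz : z ∈ e.target) :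
    inChart (gradSq g u) e z = chartPairing g e u u z := by
  rw [inChart, gradSq_eq hu he (e.map_target hz), e.right_inv hz]
  exact Complex.conj_eq_iff_re.1 (conj_chartPairing (hu e he) (hu e he) he hz)

lemma pairing_comm (hu : IsSmooth n u) (hv : IsSmooth n v) (x : X) :
    pairing g u v x = pairing g v u x := by
  rw [pairing, pairing, ← conj_chartPairing (hu _ (chart_mem_atlas _ x))
    (hv _ (chart_mem_atlas _ x)) (chart_mem_atlas _ x) (mem_chart_target _ x), Complex.conj_re]

lemma gradSq_nonneg (hu : IsSmooth n u) (x : X) : 0 ≤ gradSq g u x := by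
  have he := chart_mem_atlas (Fin n → ℂ) x
  change 0 ≤ (chartPairing g _ u u _).re
  rw [chartPairing_eq_star (hu _ he) (mem_chart_target _ x)]
  exact re_star_dotProduct_mulVec_nonneg (metric_posDef he (mem_chart_target _ x)).inv _

lemma pairing_sq_le (hu : IsSmooth n u) (hv : IsSmooth n v) (x : X) :
    pairing g u v x ^ 2 ≤ pairing g u u x * pairing g v v x := by
  have he := chart_mem_atlas (Fin n → ℂ) x
  have hz := mem_chart_target (Fin n → ℂ) x
  simp only [pairing]
  rw [chartPairing_eq_star (hu _ he) hz, chartPairing_eq_star (hv _ he) hz,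
    chartPairing_eq_star (hv _ he) hz]
  refine le_trans ?_ (norm_star_dotProduct_mulVec_sq_le (metric_posDef he hz).inv _ _)
  exact sq_le_sq.2 ((Complex.abs_re_le_norm _).trans (le_abs_self _))

lemma laplacian_gradSq_eq (hu : IsSmooth n u) (he : e ∈ atlas (Fin n → ℂ) X)
    (hx : x ∈ e.source) :
    laplacian g (gradSq g u) x = (∑ j, ∑ k, metricInv g e j k (e x)
      * dz j (dzbar k (chartPairing g e u u)) (e x)).re := by
  rw [laplacian_eq hu.gradSq he hx, chartLaplacian]
  have h : ∀ y ∈ e.target, inChart (gradSq g u) e =ᶠ[𝓝 y] chartPairing g e u u := fun y hy => by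
    filter_upwards [e.open_target.mem_nhds hy] with w hw
    exact inChart_gradSq hu he hw
  have h' : ∀ j k, hess (gradSq g u) e j k (e x)
      = dz j (dzbar k (chartPairing g e u u)) (e x) := fun j k => by
    refine dz_congr ?_
    filter_upwards [e.open_target.mem_nhds (e.map_source hx)] with y hy
    exact dzbar_congr (h y hy)
  simp only [h']

lemma sum_gradUp_mul_dz_chartLaplacian (hu : IsSmooth n u) (he : e ∈ atlas (Fin n → ℂ) X)
    (hz : z ∈ e.target) :
    ∑ j, gradUp g u e j z * dz j (chartLaplacian g e u) z
      = chartPairing g e (laplacian g u) u z := by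
  have hL : inChart (laplacian g u) e =ᶠ[𝓝 z] chartLaplacian g e u := by
    filter_upwards [e.open_target.mem_nhds hz] with y hy
    exact inChart_laplacian hu he hy
  rw [chartPairing_eq_sum_gradUp]
  exact Finset.sum_congr rfl fun j _ => by rw [dz_congr hL]

lemma sum_gradUpBar_mul_dzbar_chartLaplacian (hu : IsSmooth n u)
    (he : e ∈ atlas (Fin n → ℂ) X) (hz : z ∈ e.target) :
    ∑ q, gradUpBar g u e q z * dzbar q (chartLaplacian g e u) z
      = chartPairing g e u (laplacian g u) z := by
  have hL : inChart (laplacian g u) e =ᶠ[𝓝 z] chartLaplacian g e u := by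
    filter_upwards [e.open_target.mem_nhds hz] with y hy
    exact inChart_laplacian hu he hy
  rw [chartPairing_eq_sum_gradUpBar]
  exact Finset.sum_congr rfl fun q _ => by rw [dzbar_congr hL, mul_comm]

/-- `Ric(∇u, ∇u) = |∇u|² - u_{j\bar k} ∇^j u ∇^{\bar k} u` for a Ricci potential `u`. -/
lemma sum_ricci_mul_gradUp_mul_gradUpBar (hRic : IsRicciPotential g u)
    (he : e ∈ atlas (Fin n → ℂ) X) (hz : z ∈ e.target) :
    ∑ j, ∑ q, ricci g e j q z * gradUp g u e j z * gradUpBar g u e q z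
      = chartPairing g e u u z - chartHessGradGrad g e u z := by
  have hR : ∀ j q, ricci g e j q z = metric g e z j q - hess u e j q z :=
    fun j q => by linear_combination hRic e he z hz j q
  simp only [hR, sub_mul, Finset.sum_sub_distrib]
  rw [chartHessGradGrad, chartPairing_eq_sum_gradUp]
  congr 1
  refine Finset.sum_congr rfl fun j _ => ?_
  rw [← sum_metric_mul_gradUpBar (g := g) he hz j, Finset.mul_sum]
  exact Finset.sum_congr rfl fun q _ => by ring

/-- The Bochner formula for a Ricci potential. The number `N` is `|∇∇̄u|²`, and `|∇∇u|² ≥ 0` is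
dropped. -/
lemma exists_bochner_le (hu : IsSmooth n u) (hRic : IsRicciPotential g u) (x : X) :
    ∃ N : ℝ, 0 ≤ N ∧ ‖hessGradGrad g u x‖ ^ 2 ≤ N * gradSq g u x ^ 2 ∧
      N + 2 * pairing g (laplacian g u) u x + gradSq g u x - (hessGradGrad g u x).re
        ≤ laplacian g (gradSq g u) x := by
  obtain ⟨e, he, hx⟩ : ∃ e ∈ atlas (Fin n → ℂ) X, x ∈ e.source :=
    ⟨_, chart_mem_atlas _ x, mem_chart_source _ x⟩
  have hz : e x ∈ e.target := e.map_source hx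
  have hP := (metric_posDef (g := g) he hz).inv
  have hH := hessMat_isHermitian (hu e he) hz
  rw [hessGradGrad_eq hu he hx, gradSq_eq hu he hx]
  refine ⟨_, re_trace_mul_mul_mul_self_nonneg hP hH, ?_, ?_⟩
  · have hb : (fun k => dzbar k (inChart u e) (e x))
        = star fun j => dz j (inChart u e) (e x) := by
      ext j
      exact (conj_dz (hu e he) hz j).symm
    rw [chartHessGradGrad_eq_dotProduct, chartPairing_eq_star (hu e he) hz, hb]
    exact norm_hermitian_form_sq_le hP hH _
  · have hT := re_trace_mul_mul_transpose_mul_conjTranspose_nonneg hP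
      (Matrix.of fun i j => covHess g u e i j (e x))
    have hL : IsSmooth n (laplacian g u) := hu.laplacian
    have h4 := pairing_eq (g := g) hu hL he hx
    rw [pairing_comm hu hL] at h4
    rw [laplacian_gradSq_eq hu he hx, chart_bochner (hu e he) he hz,
      sum_gradUp_mul_dz_chartLaplacian hu he hz, sum_gradUpBar_mul_dzbar_chartLaplacian hu he hz,
      sum_ricci_mul_gradUp_mul_gradUpBar hRic he hz]
    simp only [Complex.add_re, Complex.sub_re, ← h4, ← pairing_eq hL hu he hx]
    linarith

/-- The elementary inequality behind the estimate: with `s = |∇∇̄u|` it amounts to the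
definiteness of a quadratic form in `s`, `S` and `M`. -/
lemma mul_le_of_bochner {f N b L M S D : ℝ} (hf : 0 ≤ f) (hN : 0 ≤ N) (hb : 0 ≤ b)
    (hbN : b ^ 2 ≤ N * f ^ 2) (hfS : f ≤ S) (hLM : |L| ≤ M)
    (hD : f * N - f * b - 3 * f * L ^ 2 ≤ D) :
    (S + M) * b ≤ 5 * (S + M) ^ 2 * f + D := by
  obtain ⟨s, hs, rfl⟩ : ∃ s : ℝ, 0 ≤ s ∧ N = s ^ 2 :=
    ⟨√N, Real.sqrt_nonneg _, (Real.sq_sqrt hN).symm⟩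
  have hM : 0 ≤ M := (abs_nonneg L).trans hLM
  have hS : 0 ≤ S := hf.trans hfS
  have hbs : b ≤ s * f := by
    rw [← mul_pow] at hbN
    exact (pow_le_pow_iff_left₀ hb (mul_nonneg hs hf) two_ne_zero).1 hbN
  have hL : L ^ 2 ≤ M ^ 2 := sq_le_sq' (abs_le.1 hLM).1 (abs_le.1 hLM).2
  have h1 : (S + M + f) * b ≤ (S + M + S) * (s * f) :=
    mul_le_mul (by linarith) hbs hb (by linarith)
  have h2 : 0 ≤ s ^ 2 + 5 * (S + M) ^ 2 - 3 * M ^ 2 - (S + M + S) * s := by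
    nlinarith [sq_nonneg (2 * s - (2 * S + M)), mul_nonneg hS hM]
  nlinarith [mul_nonneg hf h2, mul_le_mul_of_nonneg_left hL hf]

/-- The pointwise estimate: the left-hand side is bounded by `|∇u|²` up to a term that integrates
to zero by Green's formula. -/
lemma pointwise_estimate (hu : IsSmooth n u) (hRic : IsRicciPotential g u) {S M : ℝ}
    (hS : gradSq g u x ≤ S) (hM : |laplacian g u x| ≤ M) :
    (S + M) * ‖hessGradGrad g u x‖ ≤ 5 * (S + M) ^ 2 * gradSq g u x
      + ((gradSq g u x * laplacian g (gradSq g u) x + pairing g (gradSq g u) (gradSq g u) x)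
        - 2 * (gradSq g u x * laplacian g u x * laplacian g u x
          + pairing g (fun y => gradSq g u y * laplacian g u y) u x)) := by
  obtain ⟨N, hN, hbN, hboch⟩ := exists_bochner_le hu hRic x
  have hf := gradSq_nonneg (g := g) hu x
  refine mul_le_of_bochner hf hN (norm_nonneg _) hbN hS hM ?_
  rw [pairing_mul hu.gradSq hu.laplacian]
  have hcs : pairing g (gradSq g u) u x ^ 2
      ≤ pairing g (gradSq g u) (gradSq g u) x * gradSq g u x := pairing_sq_le hu.gradSq hu x
  have hq : 0 ≤ pairing g (gradSq g u) (gradSq g u) x := gradSq_nonneg hu.gradSq x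
  have hB : (hessGradGrad g u x).re ≤ ‖hessGradGrad g u x‖ := Complex.re_le_norm _
  revert hcs hq hB hboch hf
  generalize gradSq g u x = f
  generalize pairing g (gradSq g u) (gradSq g u) x = q
  generalize pairing g (gradSq g u) u x = p
  generalize laplacian g u x = L
  generalize pairing g (laplacian g u) u x = r
  generalize laplacian g (gradSq g u) x = F
  generalize (hessGradGrad g u x).re = B
  generalize ‖hessGradGrad g u x‖ = b
  intro hboch hf hcs hq hB
  -- Completing the square `|∂f - L ∂u|² ≥ 0`.
  have hsq : 2 * (L * p) ≤ q + L ^ 2 * f := by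
    refine (abs_le_of_sq_le_sq' ?_ (by positivity)).2
    nlinarith [sq_nonneg (q - L ^ 2 * f), mul_le_mul_of_nonneg_left hcs (sq_nonneg L)]
  nlinarith [mul_le_mul_of_nonneg_left hboch hf, mul_le_mul_of_nonneg_left hB hf, mul_nonneg hf hf]

variable [T2Space X] [CompactSpace X] [MeasurableSpace X] [BorelSpace X]

lemma norm_integral_hessGradGrad_le (hu : IsSmooth n u) (hRic : IsRicciPotential g u) {S M : ℝ}
    (hS : ∀ x, gradSq g u x ≤ S) (hM : ∀ x, |laplacian g u x| ≤ M) (hSM : 0 ≤ S + M) :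
    ‖∫ x, hessGradGrad g u x ∂(volumeMeasure g)‖
      ≤ 5 * (S + M) * ∫ x, gradSq g u x ∂(volumeMeasure g) := by
  have hf : IsSmooth n (gradSq g u) := hu.gradSq
  have hL : IsSmooth n (laplacian g u) := hu.laplacian
  have hB := continuous_hessGradGrad (g := g) hu
  have hBi : Integrable (fun x => ‖hessGradGrad g u x‖) (volumeMeasure g) :=
    hB.norm.integrable_of_hasCompactSupport (.of_compactSpace _)
  refine (norm_integral_le_integral_norm _).trans ?_
  rcases hSM.eq_or_lt with h0 | hpos
  · -- Any point gives `0 ≤ M`, hence `|∇u|² ≤ S ≤ 0` there.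
    have hzero : ∀ x, ‖hessGradGrad g u x‖ = 0 := fun x => by
      have h1 := (abs_nonneg _).trans (hM x)
      have h2 : gradSq g u x = 0 := le_antisymm ((hS x).trans (by linarith)) (gradSq_nonneg hu x)
      obtain ⟨N, -, hN, -⟩ := exists_bochner_le hu hRic x
      rw [h2, zero_pow two_ne_zero, mul_zero] at hN
      exact pow_eq_zero_iff two_ne_zero |>.1 (le_antisymm hN (sq_nonneg _))
    simp [hzero, ← h0]
  · have h1 := integral_green (g := g) hf hf
    have h2 := integral_green (g := g) hu (hf.mul hL)
    have hi1 : Integrable (fun x => gradSq g u x * laplacian g (gradSq g u) x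
        + pairing g (gradSq g u) (gradSq g u) x) (volumeMeasure g) :=
      (hf.mul hf.laplacian).integrable.add (hf.pairing hf).integrable
    have hi2 : Integrable (fun x => gradSq g u x * laplacian g u x * laplacian g u x
        + pairing g (fun y => gradSq g u y * laplacian g u y) u x) (volumeMeasure g) :=
      ((hf.mul hL).mul hL).integrable.add ((hf.mul hL).pairing hu).integrable
    have h3 := integral_mono (hBi.const_mul (S + M))
      ((hf.integrable.const_mul (5 * (S + M) ^ 2)).add (hi1.sub (hi2.const_mul 2)))
      fun x => pointwise_estimate hu hRic (hS x) (hM x)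
    rw [integral_const_mul, integral_add' (hf.integrable.const_mul _) (hi1.sub (hi2.const_mul 2)),
      integral_sub' hi1 (hi2.const_mul 2), integral_const_mul, integral_const_mul, h1, h2] at h3
    refine le_of_mul_le_mul_left ?_ hpos
    linarith

end Estimate

end Kahler

theorem lemma3p3 {n : ℕ} {X : Type*} [TopologicalSpace X] [T2Space X] [CompactSpace X]
    [ChartedSpace (Fin n → ℂ) X] [IsManifold 𝓘(ℂ, Fin n → ℂ) ω X]
    [MeasurableSpace X] [BorelSpace X]
    (g : Kahler.KahlerMetric n X) (u : X → ℝ)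
    (hu : ContMDiff 𝓘(ℝ, Fin n → ℂ) 𝓘(ℝ, ℝ) ∞ u)
    (hRic : Kahler.IsRicciPotential g u) :
    Integrable (Kahler.hessGradGrad g u) (Kahler.volumeMeasure g) ∧
    Integrable (Kahler.gradSq g u) (Kahler.volumeMeasure g) ∧
    BddAbove (Set.range fun x => √(Kahler.gradSq g u x)) ∧
    BddAbove (Set.range fun x => |Kahler.laplacian g u x|) ∧
    ‖∫ x, Kahler.hessGradGrad g u x ∂(Kahler.volumeMeasure g)‖ ≤
      5 * ((⨆ x, √(Kahler.gradSq g u x)) ^ 2 + ⨆ x, |Kahler.laplacian g u x|) *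
        ∫ x, Kahler.gradSq g u x ∂(Kahler.volumeMeasure g) := by
  open Kahler in
  have hs : IsSmooth n u := isSmooth_of_contMDiff hu
  have hB : Integrable (hessGradGrad g u) (volumeMeasure g) :=
    (continuous_hessGradGrad hs).integrable_of_hasCompactSupport (.of_compactSpace _)
  have hf : Integrable (gradSq g u) (volumeMeasure g) := hs.gradSq.integrable
  have hbS : BddAbove (Set.range fun x => √(gradSq g u x)) :=
    (isCompact_range hs.gradSq.continuous.sqrt).bddAbove
  have hbM : BddAbove (Set.range fun x => |laplacian g u x|) :=
    (isCompact_range hs.laplacian.continuous.abs).bddAbove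
  refine ⟨hB, hf, hbS, hbM, ?_⟩
  exact norm_integral_hessGradGrad_le hs hRic
    (fun x => by
      rw [← Real.sq_sqrt (gradSq_nonneg hs x)]
      exact pow_le_pow_left₀ (Real.sqrt_nonneg _) (le_ciSup hbS x) 2)
    (fun x => le_ciSup hbM x)
    (add_nonneg (sq_nonneg _) (Real.iSup_nonneg fun x => abs_nonneg _))
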